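/- **Setting.** Let $d\ge 1$ and let $\mu$ be a probability measure on $\mathbb R^d$, the known prior of a parameter $\ell^*$. A bandit algorithm with horizon $T$ recommends in each round $t=1,\dots,T$ an action $A^{(t)}$ in the closed Euclidean unit ball of $\mathbb R^d$; the action is a measurable function of the previously observed rewards and of external randomness independent of $\ell^*$ and of the noise. It then observes $r^{(t)}=\langle A^{(t)},\ell^*\rangle+w_t$ with i.i.d. noise $w_t\sim N(0,1)$ independent of $\ell^*$. The algorithm is *Bayesian incentive compatible (BIC)* if for every $t\le T$, almost surely, $\mathbb E[\langle \ell^*,a\rangle\mid A^{(t)}]$ is maximized over all $a$ in the unit ball by $a=A^{(t)}$. It achieves *$\lambda$-spectral exploration* if almost surely $\sum_{t=1}^T A^{(t)}(A^{(t)})^{\top}\succeq\lambda I$. Repeating an algorithm $N$ times means running it $N$ times in succession, each run with fresh external randomness and using only the rewards of that run. **Assumption.** For constants $c_d,\epsilon_d,\sigma,K>0$ and every unit vector $v$: $\Pr(\langle v,\ell^*\rangle\ge c_d)\ge\epsilon_d$; $\mathrm{Var}(\langle v,\ell^*\rangle)\ge\sigma$; and $\Pr(|\langle v,\ell^*\rangle|\ge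 t)\le 2e^{-t^2/K^2}$ for all $t>0$. **Theorem.** There is an absolute exponent $p\in\mathbb N$, and for every $K>0$ there is a constant $C=C(K)>0$, such that the following holds for all $d\ge1$ and all $\mu,c_d,\epsilon_d,\sigma$ satisfying the assumption. 1. For every $\lambda$ with $0<\lambda\le\min(1,\sigma/d)$ there is a BIC algorithm that achieves $\lambda$-spectral exploration and whose number of rounds is at most $$C\,\max\Big(1,\log\frac1{\sigma\epsilon_dc_d}\Big)\Big(\frac{d^5}{\lambda^4\sigma^2}+\frac{d^4}{c_d^2\lambda^4}\Big).$$ Moreover, for every $\bar\lambda>0$, this algorithm repeated $\lceil\bar\lambda/\lambda\rceil$ times is BIC and achieves $\bar\lambda$-spectral exploration. 2. For every $\bar\lambda>0$ there is a BIC algorithm that achieves $\bar\lambda$-spectral exploration in at most $$C\,\max(1,\bar\lambda)\Big(\frac{d}{\min(\sigma,c_d)}\Big)^{p}\log\frac1{\epsilon_d}$$ rounds. -/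

import Mathlib

open MeasureTheory ProbabilityTheory

noncomputable section

/-- `ℓ* ~ μ` on `ℝ^d` is not confined to a half-space (constants `c`, `ε`), has covariance
bounded below by `σ`, and is sub-gaussian with constant `K`. -/
structure PriorAssumption {d : ℕ} (μ : Measure (EuclideanSpace ℝ (Fin d)))
    (c ε σ K : ℝ) : Prop where
  c_pos : 0 < c
  ε_pos : 0 < ε
  σ_pos : 0 < σ
  K_pos : 0 < K
  halfspace : ∀ v : EuclideanSpace ℝ (Fin d), ‖v‖ = 1 → ε ≤ μ.real {x | c ≤ inner ℝ v x}
  covariance : ∀ v : EuclideanSpace ℝ (Fin d), ‖v‖ = 1 →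
    σ ≤ variance (fun x => inner ℝ v x) μ
  subgaussian : ∀ v : EuclideanSpace ℝ (Fin d), ‖v‖ = 1 → ∀ t : ℝ, 0 < t →
    μ.real {x | t ≤ |inner ℝ v x|} ≤ 2 * Real.exp (-t ^ 2 / K ^ 2)

/-- A randomized bandit algorithm with action set the closed unit ball of `ℝ^d`, running for
`horizon` rounds `t = 0, …, horizon - 1`. The action of round `t` is a measurable function of
the external randomness (the seed) and of the rewards of the rounds before `t`; the earlier
actions are themselves functions of these. -/
structure BanditAlgorithm (d : ℕ) where
  Seed : Type
  [measurableSeed : MeasurableSpace Seed]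
  seedLaw : Measure Seed
  [isProb : IsProbabilityMeasure seedLaw]
  horizon : ℕ
  act : (t : ℕ) → Seed → (Fin t → ℝ) → EuclideanSpace ℝ (Fin d)
  norm_act_le : ∀ t s h, ‖act t s h‖ ≤ 1
  measurable_act : ∀ t, Measurable (fun p : Seed × (Fin t → ℝ) => act t p.1 p.2)

namespace BanditAlgorithm

attribute [instance] BanditAlgorithm.measurableSeed BanditAlgorithm.isProb

variable {d : ℕ}

/-- A sample point: the parameter `ℓ*`, the seed, and the reward noises `w_0, w_1, …`. -/
abbrev Env (alg : BanditAlgorithm d) : Type :=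
  EuclideanSpace ℝ (Fin d) × alg.Seed × (ℕ → ℝ)

/-- The joint law: `ℓ* ~ μ`, the seed, and i.i.d. `N(0,1)` noises, all independent. -/
def law (alg : BanditAlgorithm d) (μ : Measure (EuclideanSpace ℝ (Fin d))) :
    Measure alg.Env :=
  μ.prod (alg.seedLaw.prod (Measure.infinitePi (fun _ : ℕ => gaussianReal 0 1)))

/-- The reward `r_t = ⟨A_t, ℓ*⟩ + w_t`, where `A_t` is computed from the earlier rewards. -/
def reward (alg : BanditAlgorithm d) (ω : alg.Env) (t : ℕ) : ℝ :=
  inner ℝ (alg.act t ω.2.1 (fun i : Fin t => alg.reward ω i)) ω.1 + ω.2.2 t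
termination_by t
decreasing_by exact i.2

/-- The action `A_t` recommended in round `t`. -/
def action (alg : BanditAlgorithm d) (t : ℕ) (ω : alg.Env) : EuclideanSpace ℝ (Fin d) :=
  alg.act t ω.2.1 (fun i : Fin t => alg.reward ω i)

theorem measurable_reward (alg : BanditAlgorithm d) (t : ℕ) :
    Measurable (fun ω : alg.Env => alg.reward ω t) := by
  induction t using Nat.strong_induction_on with
  | _ t ih =>
    have h : Measurable (fun ω : alg.Env => (fun i : Fin t => alg.reward ω i)) :=
      measurable_pi_lambda _ (fun i => ih i i.2)
    have ha : Measurable (fun ω : alg.Env =>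
        alg.act t ω.2.1 (fun i : Fin t => alg.reward ω i)) :=
      (alg.measurable_act t).comp (measurable_snd.fst.prodMk h)
    have e : (fun ω : alg.Env => alg.reward ω t) = fun ω =>
        inner ℝ (alg.act t ω.2.1 (fun i : Fin t => alg.reward ω i)) ω.1 + ω.2.2 t := by
      funext ω
      rw [reward]
    rw [e]
    exact (ha.inner measurable_fst).add ((measurable_pi_apply t).comp measurable_snd.snd)

/-- Hence `σ(A_t)` is a sub-σ-algebra, and conditioning on it below is meaningful. -/
theorem measurable_action (alg : BanditAlgorithm d) (t : ℕ) : Measurable (alg.action t) :=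
  (alg.measurable_act t).comp
    (measurable_snd.fst.prodMk (measurable_pi_lambda _ (fun i => alg.measurable_reward i)))

/-- Bayesian incentive compatibility: in every round, almost surely, the recommended action
maximizes `a ↦ E[⟨ℓ*, a⟩ | A_t] = ⟨E[ℓ* | A_t], a⟩` over the unit ball. -/
def IsBIC (alg : BanditAlgorithm d) (μ : Measure (EuclideanSpace ℝ (Fin d))) : Prop :=
  ∀ t < alg.horizon, ∀ᵐ ω ∂(alg.law μ),
    IsMaxOn
      (fun a : EuclideanSpace ℝ (Fin d) =>
        inner ℝ
          (((alg.law μ)[fun ω' : alg.Env => ω'.1 |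
            MeasurableSpace.comap (alg.action t) inferInstance]) ω) a)
      (Metric.closedBall 0 1) (alg.action t ω)

/-- `lam`-spectral exploration, almost surely: `∑_t A_t A_tᵀ ⪰ lam • I`. -/
def SpectrallyExplores (alg : BanditAlgorithm d) (μ : Measure (EuclideanSpace ℝ (Fin d)))
    (lam : ℝ) : Prop :=
  ∀ᵐ ω ∂(alg.law μ),
    ((∑ t ∈ Finset.range alg.horizon,
        Matrix.vecMulVec (alg.action t ω).ofLp (alg.action t ω).ofLp) -
      lam • (1 : Matrix (Fin d) (Fin d) ℝ)).PosSemidef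

/-- The algorithm run `N` times in succession. Each run uses its own independent seed and only
the rewards observed during that run. -/
def repeatRuns (alg : BanditAlgorithm d) (N : ℕ) : BanditAlgorithm d where
  Seed := ℕ → alg.Seed
  seedLaw := Measure.infinitePi (fun _ : ℕ => alg.seedLaw)
  horizon := N * alg.horizon
  act t s h :=
    alg.act (t % alg.horizon) (s (t / alg.horizon))
      (fun i => h ⟨t / alg.horizon * alg.horizon + i, by
        have h1 := Nat.div_add_mod' t alg.horizon
        have h2 := i.2
        omega⟩)
  norm_act_le t s h := alg.norm_act_le _ _ _
  measurable_act t := by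
    refine (alg.measurable_act (t % alg.horizon)).comp (Measurable.prodMk ?_ ?_)
    · exact (measurable_pi_apply (t / alg.horizon)).comp measurable_fst
    · exact measurable_pi_lambda _ (fun i => (measurable_pi_apply _).comp measurable_snd)

end BanditAlgorithm

end

/-!
A unit vector `a` may be recommended on an observable event `G` as soon as `E[ℓ*; G]` is a
nonnegative multiple of `a`; recommending the direction of the prior mean regardless of the data is
always compatible. So the task is to choose events `G` for which `E[ℓ*; G]` points in a direction
not yet explored, while the data only carry information about the directions explored before.

Once the actions span a subspace `V`, linear combinations of the rewards give unbiased estimates of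
`⟨v, ℓ*⟩`, `v ∈ V`, with small Gaussian errors. Recommendations based on the sign or the size of
such an estimate make `⟨v, E[ℓ*; G]⟩` substantially positive, for every unit `v ∈ V`. By convexity
`E[ℓ*; G]` can then be prescribed on `V` within a small ball, after a further randomization.

Every run draws a uniform exploration seed. Seeds that must explore contribute a multiple of the
prior mean to `E[ℓ*; G]`; the informed seeds are steered so as to cancel this contribution.

* Initially, a fraction `q` of the informed seeds explores at a time. Cancelling the component of
  the mean in `V` leaves a vector of `Vᗮ`, which is explored. After `d - 1` steps the seeds below
  `q ^ (d - 1)` know all directions.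
* Then the set of fully informed seeds is doubled, again and again. All directions being known,
  `E[ℓ*; G]` can be given a definite component in any chosen new direction, which is therefore
  explored in polynomially many rounds. About `d * log₂ (1 / q)` doublings reach all seeds, so
  `ε` enters the number of rounds only through its logarithm.

Each block of rounds in a combined direction is followed by a block along the prior mean, from
which the new direction is recovered by subtraction.
-/

/-! ### Recommendations aligned with conditional means -/

section AlignedLevelSets

variable {Ω E : Type*} [MeasurableSpace Ω] {P : Measure Ω}

theorem condExp_comap_apply_eq_setAverage {β : Type*} [MeasurableSpace β]
    [MeasurableSingletonClass β] [NormedAddCommGroup E] [NormedSpace ℝ E] [CompleteSpace E]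
    [IsFiniteMeasure P] {f : Ω → E} {A : Ω → β} (hf : Integrable f P) (hA : Measurable A) {ω : Ω}
    (hω : P (A ⁻¹' {A ω}) ≠ 0) :
    (P[f | MeasurableSpace.comap A inferInstance]) ω = ⨍ ω' in A ⁻¹' {A ω}, f ω' ∂P := by
  set g := P[f | MeasurableSpace.comap A inferInstance]
  have hfactors : g.FactorsThrough A := stronglyMeasurable_condExp.factorsThrough
  have hset : ∫ ω' in A ⁻¹' {A ω}, g ω' ∂P = ∫ ω' in A ⁻¹' {A ω}, f ω' ∂P :=
    setIntegral_condExp hA.comap_le hf ⟨{A ω}, measurableSet_singleton _, rfl⟩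
  have hconst : ∫ ω' in A ⁻¹' {A ω}, g ω' ∂P = P.real (A ⁻¹' {A ω}) • g ω := by
    rw [← setIntegral_const]
    exact setIntegral_congr_fun (hA (measurableSet_singleton _)) fun ω' hω' => hfactors hω'
  rw [setAverage_eq, ← hset, hconst, inv_smul_smul₀]
  exact (measureReal_ne_zero_iff (measure_ne_top _ _)).2 hω

variable [NormedAddCommGroup E] [InnerProductSpace ℝ E]

theorem isMaxOn_inner_smul_closedBall {x : E} (hx : ‖x‖ = 1) {R : ℝ} (hR : 0 ≤ R) :
    IsMaxOn (fun a : E => inner ℝ (R • x) a) (Metric.closedBall 0 1) x := by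
  intro a ha
  have hxa : inner ℝ x a ≤ 1 := by
    refine (real_inner_le_norm x a).trans ?_
    rw [hx, one_mul]
    simpa using ha
  simpa [real_inner_smul_left, hx] using mul_le_mul_of_nonneg_left hxa hR

/-- `A` takes finitely many values, all of them unit vectors, and the integral of `f` over each
level set `{A = x}` is a nonnegative multiple of `x`. For an action `A` and a parameter `f` this is
the form of incentive compatibility that survives case distinctions and independent runs. -/
def HasAlignedLevelSets (P : Measure Ω) (f A : Ω → E) : Prop :=
  ∃ F : Finset E, (∀ ω, A ω ∈ F) ∧
    ∀ x ∈ F, ‖x‖ = 1 ∧ ∃ R : ℝ, 0 ≤ R ∧ ∫ ω in A ⁻¹' {x}, f ω ∂P = R • x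

namespace HasAlignedLevelSets

variable {f A : Ω → E}

theorem ae_isMaxOn_condExp [MeasurableSpace E] [BorelSpace E] [CompleteSpace E] [IsFiniteMeasure P]
    (h : HasAlignedLevelSets P f A) (hf : Integrable f P) (hA : Measurable A) :
    ∀ᵐ ω ∂P, IsMaxOn (fun a : E => inner ℝ ((P[f | MeasurableSpace.comap A inferInstance]) ω) a)
      (Metric.closedBall 0 1) (A ω) := by
  obtain ⟨F, hAF, hF⟩ := h
  have hnull : ∀ᵐ ω ∂P, ∀ x ∈ F, P (A ⁻¹' {x}) = 0 → A ω ≠ x :=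
    (ae_ball_iff F.countable_toSet).2 fun x _ =>
      Filter.eventually_imp_distrib_left.2 fun h0 => measure_eq_zero_iff_ae_notMem.1 h0
  filter_upwards [hnull] with ω hω
  obtain ⟨hnorm, R, hR, hint⟩ := hF (A ω) (hAF ω)
  have hpos : P (A ⁻¹' {A ω}) ≠ 0 := fun h0 => hω _ (hAF ω) h0 rfl
  rw [condExp_comap_apply_eq_setAverage hf hA hpos, setAverage_eq, hint, smul_smul]
  exact isMaxOn_inner_smul_closedBall hnorm (by positivity)

theorem const {x : E} (hx : ‖x‖ = 1) {R : ℝ} (hR : 0 ≤ R) (hint : ∫ ω, f ω ∂P = R • x) :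
    HasAlignedLevelSets P f fun _ => x := by
  refine ⟨{x}, fun _ => Finset.mem_singleton_self x, fun y hy => ?_⟩
  obtain rfl := Finset.mem_singleton.1 hy
  exact ⟨hx, R, hR, by simpa using hint⟩

theorem comp_measurePreserving {Ω' : Type*} [MeasurableSpace Ω'] {P' : Measure Ω'} {φ : Ω' → Ω}
    [MeasurableSpace E] [BorelSpace E]
    (h : HasAlignedLevelSets P f A) (hf : AEStronglyMeasurable f P) (hA : Measurable A)
    (hφ : MeasurePreserving φ P' P) : HasAlignedLevelSets P' (f ∘ φ) (A ∘ φ) := by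
  obtain ⟨F, hAF, hF⟩ := h
  refine ⟨F, fun ω => hAF _, fun x hx => ?_⟩
  obtain ⟨hnorm, R, hR, hint⟩ := hF x hx
  refine ⟨hnorm, R, hR, ?_⟩
  rw [← hint, ← hφ.map_eq, setIntegral_map (hA (measurableSet_singleton x))
    (hφ.map_eq.symm ▸ hf) hφ.measurable.aemeasurable]
  rfl

open scoped Classical in
theorem ite_of_ne {S : Set Ω} {x y : E} (hx : ‖x‖ = 1) (hy : ‖y‖ = 1) (hxy : x ≠ y) {R R' : ℝ}
    (hR : 0 ≤ R) (hR' : 0 ≤ R') (hS : ∫ ω in S, f ω ∂P = R • x)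
    (hS' : ∫ ω in Sᶜ, f ω ∂P = R' • y) :
    HasAlignedLevelSets P f fun ω => if ω ∈ S then x else y := by
  have hpre_x : (fun ω => if ω ∈ S then x else y) ⁻¹' {x} = S := by
    ext ω
    by_cases hω : ω ∈ S <;> simp [hω, hxy.symm]
  have hpre_y : (fun ω => if ω ∈ S then x else y) ⁻¹' {y} = Sᶜ := by
    ext ω
    by_cases hω : ω ∈ S <;> simp [hω, hxy]
  refine ⟨{x, y}, fun ω => by by_cases hω : ω ∈ S <;> simp [hω], fun z hz => ?_⟩
  rcases Finset.mem_insert.1 hz with rfl | hz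
  · exact ⟨hx, R, hR, by rwa [hpre_x]⟩
  · obtain rfl := Finset.mem_singleton.1 hz
    exact ⟨hy, R', hR', by rwa [hpre_y]⟩

open scoped Classical in
theorem ite {S : Set Ω} {x y : E} (hf : Integrable f P) (hSm : MeasurableSet S) (hx : ‖x‖ = 1)
    (hy : ‖y‖ = 1) {R R' : ℝ} (hR : 0 ≤ R) (hR' : 0 ≤ R') (hS : ∫ ω in S, f ω ∂P = R • x)
    (hS' : ∫ ω in Sᶜ, f ω ∂P = R' • y) :
    HasAlignedLevelSets P f fun ω => if ω ∈ S then x else y := by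
  rcases eq_or_ne x y with rfl | hxy
  · simp only [ite_self]
    exact const hx (add_nonneg hR hR') (by rw [← integral_add_compl hSm hf, hS, hS', add_smul])
  · exact ite_of_ne hx hy hxy hR hR' hS hS'

end HasAlignedLevelSets

end AlignedLevelSets

namespace BanditAlgorithm

variable {d : ℕ} {alg : BanditAlgorithm d} {μ : Measure (EuclideanSpace ℝ (Fin d))} {lam lam' : ℝ}

instance [IsProbabilityMeasure μ] : IsProbabilityMeasure (alg.law μ) := by
  unfold law
  infer_instance

/-- In every round the recommendation takes finitely many values, each of them aligned with the
integral of the parameter over the event that it is recommended. -/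
def IsFinitelyBIC (alg : BanditAlgorithm d) (μ : Measure (EuclideanSpace ℝ (Fin d))) : Prop :=
  ∀ t < alg.horizon, HasAlignedLevelSets (alg.law μ) (fun ω => ω.1) (alg.action t)

theorem IsFinitelyBIC.isBIC [IsProbabilityMeasure μ] (h : alg.IsFinitelyBIC μ)
    (hμ : Integrable (fun x => x) μ) : alg.IsBIC μ := fun t ht =>
  (h t ht).ae_isMaxOn_condExp (hμ.comp_fst _) (alg.measurable_action t)

theorem reward_eq (ω : alg.Env) (t : ℕ) :
    alg.reward ω t = inner ℝ (alg.action t ω) ω.1 + ω.2.2 t := by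
  rw [reward, action]

/-- The sample point seen by the `k`-th run of a repeated algorithm. -/
def runEnv (alg : BanditAlgorithm d) (N k : ℕ) (ω : (alg.repeatRuns N).Env) : alg.Env :=
  (ω.1, (show ℕ → alg.Seed from ω.2.1) k, fun i => ω.2.2 (k * alg.horizon + i))

theorem measurePreserving_runEnv [IsProbabilityMeasure μ] (N k : ℕ) :
    MeasurePreserving (alg.runEnv N k) ((alg.repeatRuns N).law μ) (alg.law μ) := by
  have hseed : MeasurePreserving (fun s : ℕ → alg.Seed => s k)
      (Measure.infinitePi (fun _ : ℕ => alg.seedLaw)) alg.seedLaw :=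
    measurePreserving_eval_infinitePi (fun _ : ℕ => alg.seedLaw) k
  have hnoise : MeasurePreserving (fun (w : ℕ → ℝ) (i : ℕ) => w (k * alg.horizon + i))
      (Measure.infinitePi (fun _ : ℕ => gaussianReal 0 1))
      (Measure.infinitePi (fun _ : ℕ => gaussianReal 0 1)) :=
    ⟨by fun_prop, Measure.map_infinitePi_infinitePi_of_inj (P := fun _ : ℕ => gaussianReal 0 1)
      (add_right_injective (k * alg.horizon))⟩
  exact (MeasurePreserving.id μ).prod (hseed.prod hnoise)

theorem act_congr {t t' : ℕ} (ht : t = t') {s s' : alg.Seed} (hs : s = s') {h : Fin t → ℝ}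
    {h' : Fin t' → ℝ} (hh : ∀ i : Fin t, h i = h' (i.cast ht)) :
    alg.act t s h = alg.act t' s' h' := by
  subst ht hs
  rw [funext hh]
  rfl

theorem action_repeatRuns {N : ℕ} (k : ℕ) (ω : (alg.repeatRuns N).Env) {i : ℕ}
    (hi : i < alg.horizon) :
    (alg.repeatRuns N).action (k * alg.horizon + i) ω = alg.action i (alg.runEnv N k ω) := by
  induction i using Nat.strong_induction_on with
  | _ i ih =>
    have hmod : (k * alg.horizon + i) % alg.horizon = i := by
      rw [Nat.mul_comm, Nat.mul_add_mod, Nat.mod_eq_of_lt hi]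
    have hdiv : (k * alg.horizon + i) / alg.horizon = k := by
      rw [Nat.mul_comm, Nat.mul_add_div (by omega), Nat.div_eq_of_lt hi, add_zero]
    refine act_congr hmod (congrArg (show ℕ → alg.Seed from ω.2.1) hdiv) fun j => ?_
    have hj : (j : ℕ) < i := j.2.trans_eq hmod
    simp only [hdiv, reward_eq, ih j hj (hj.trans hi), Fin.val_cast]
    rfl

theorem IsFinitelyBIC.repeatRuns [IsProbabilityMeasure μ] (h : alg.IsFinitelyBIC μ) (N : ℕ) :
    (alg.repeatRuns N).IsFinitelyBIC μ := by
  intro t ht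
  have hpos : 0 < alg.horizon := Nat.pos_of_mul_pos_left (Nat.zero_lt_of_lt ht)
  have hlt : t % alg.horizon < alg.horizon := Nat.mod_lt t hpos
  have haction : (alg.repeatRuns N).action t =
      alg.action (t % alg.horizon) ∘ alg.runEnv N (t / alg.horizon) := by
    funext ω
    have hrun := action_repeatRuns (t / alg.horizon) ω hlt
    rwa [Nat.div_add_mod'] at hrun
  rw [haction]
  exact (h _ hlt).comp_measurePreserving measurable_fst.aestronglyMeasurable
    (alg.measurable_action _) (measurePreserving_runEnv N _)

theorem sum_action_repeatRuns {M : Type*} [AddCommMonoid M] (g : EuclideanSpace ℝ (Fin d) → M)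
    {N : ℕ} (ω : (alg.repeatRuns N).Env) :
    ∑ t ∈ Finset.range (alg.repeatRuns N).horizon, g ((alg.repeatRuns N).action t ω) =
      ∑ k ∈ Finset.range N, ∑ t ∈ Finset.range alg.horizon,
        g (alg.action t (alg.runEnv N k ω)) := by
  suffices ∀ n : ℕ, ∑ t ∈ Finset.range (n * alg.horizon), g ((alg.repeatRuns N).action t ω) =
      ∑ k ∈ Finset.range n, ∑ t ∈ Finset.range alg.horizon,
        g (alg.action t (alg.runEnv N k ω)) from this N
  intro n
  induction n with
  | zero => simp
  | succ n ih =>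
    rw [Nat.succ_mul, Finset.sum_range_add, ih, Finset.sum_range_succ]
    congr 1
    refine Finset.sum_congr rfl fun t ht => ?_
    rw [action_repeatRuns n ω (Finset.mem_range.1 ht)]

theorem SpectrallyExplores.mono (h : alg.SpectrallyExplores μ lam) (hle : lam' ≤ lam) :
    alg.SpectrallyExplores μ lam' := by
  filter_upwards [h] with ω hω
  convert hω.add ((Matrix.PosSemidef.one (n := Fin d) (R := ℝ)).smul (sub_nonneg.2 hle)) using 1
  module

theorem SpectrallyExplores.repeatRuns [IsProbabilityMeasure μ] (h : alg.SpectrallyExplores μ lam)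
    (N : ℕ) : (alg.repeatRuns N).SpectrallyExplores μ (N * lam) := by
  have hruns : ∀ᵐ ω ∂((alg.repeatRuns N).law μ), ∀ k : ℕ,
      ((∑ t ∈ Finset.range alg.horizon,
        Matrix.vecMulVec (alg.action t (alg.runEnv N k ω)).ofLp
          (alg.action t (alg.runEnv N k ω)).ofLp) -
      lam • (1 : Matrix (Fin d) (Fin d) ℝ)).PosSemidef :=
    ae_all_iff.2 fun k => (measurePreserving_runEnv N k).quasiMeasurePreserving.ae h
  filter_upwards [hruns] with ω hω
  convert Matrix.posSemidef_sum (Finset.range N) fun k _ => hω k using 1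
  rw [sum_action_repeatRuns fun a => Matrix.vecMulVec a.ofLp a.ofLp, Finset.sum_sub_distrib,
    Finset.sum_const, Finset.card_range, mul_smul, Nat.cast_smul_eq_nsmul]

end BanditAlgorithm

/-! ### Moments and tails -/

theorem indicator_sub_indicator_sub_sq_le_indicator {Ω : Type*} {Y ξ : Ω → ℝ} {c κ : ℝ}
    (hκ : 0 < κ) (hc : 0 < c) (ω : Ω) :
    {ω | c ≤ Y ω}.indicator (fun _ => c) ω -
        {ω | c / 2 ≤ |ξ ω|}.indicator (fun _ => c + 1 / (2 * κ)) ω - κ / 2 * Y ω ^ 2 ≤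
      {ω | c / 2 ≤ Y ω + ξ ω}.indicator Y ω := by
  have hquad : 0 ≤ κ / 2 * Y ω ^ 2 := by positivity
  simp only [Set.indicator_apply, Set.mem_ofPred_eq]
  by_cases hξ : c / 2 ≤ |ξ ω|
  · -- AM-GM: `|Y| ≤ 1 / (2 κ) + κ Y² / 2`
    have hamgm : |Y ω| ≤ 1 / (2 * κ) + κ / 2 * Y ω ^ 2 := by
      rw [← sq_abs (Y ω), ← sub_nonneg]
      have : 1 / (2 * κ) + κ / 2 * |Y ω| ^ 2 - |Y ω| = (κ * |Y ω| - 1) ^ 2 / (2 * κ) := by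
        field_simp
        ring
      rw [this]
      positivity
    rw [if_pos hξ]
    split_ifs <;> linarith [neg_abs_le (Y ω), abs_nonneg (Y ω)]
  · rw [if_neg hξ]
    have hlt := abs_lt.1 (not_le.1 hξ)
    split_ifs <;> linarith

theorem mul_div_two_le_sub_sub {B c ε : ℝ} (hc : 0 < c) (hε : 0 < ε) (hB : ε * c ^ 2 ≤ B) :
    c * ε / 2 ≤ ε * c - c ^ 2 * ε ^ 2 / (16 * B) * (c + 1 / (2 * (c * ε / (4 * B)))) -
      c * ε / (4 * B) / 2 * B := by
  have hB0 : 0 < B := lt_of_lt_of_le (by positivity) hB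
  have htail : c ^ 2 * ε ^ 2 / (16 * B) * (c + 1 / (2 * (c * ε / (4 * B)))) =
      c * ε / 16 * (ε * c ^ 2 / B) + c * ε / 8 := by
    field_simp
    ring
  have hquad : c * ε / (4 * B) / 2 * B = c * ε / 8 := by
    field_simp
    norm_num
  have hsmall : c * ε / 16 * (ε * c ^ 2 / B) ≤ c * ε / 16 :=
    mul_le_of_le_one_right (by positivity) ((div_le_one hB0).2 hB)
  have hpos : 0 < c * ε := by positivity
  linarith

section RandomVariables

variable {Ω : Type*} [MeasurableSpace Ω] {P : Measure Ω} {Y ξ : Ω → ℝ} {K B σ c ε : ℝ}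

theorem integral_Ioi_cube_mul_exp_neg_sq_div (hK : 0 < K) :
    ∫ t in Set.Ioi (0 : ℝ), t ^ (3 : ℝ) * Real.exp (-t ^ 2 / K ^ 2) = K ^ 4 / 2 := by
  have h := integral_rpow_mul_exp_neg_mul_rpow (p := 2) (q := 3) (b := (K ^ 2)⁻¹) two_pos
    (by norm_num) (by positivity)
  have hpow : (K ^ 2)⁻¹ ^ (-((3 : ℝ) + 1) / 2) = K ^ 4 := by
    rw [Real.inv_rpow (by positivity), show (-((3 : ℝ) + 1) / 2) = -(2 : ℕ) by norm_num,
      Real.rpow_neg (by positivity), inv_inv, Real.rpow_natCast]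
    ring
  have hexp : ∀ t : ℝ, -t ^ 2 / K ^ 2 = -(K ^ 2)⁻¹ * t ^ 2 := fun t => by ring
  rw [hpow, show ((3 : ℝ) + 1) / 2 = (1 : ℕ) + 1 by norm_num, Real.Gamma_nat_eq_factorial] at h
  simp only [Real.rpow_two, Nat.factorial_one, Nat.cast_one, mul_one, mul_one_div] at h
  simpa only [hexp] using h

theorem lintegral_pow_four_le_of_subgaussian_tail [IsFiniteMeasure P] (hY : AEMeasurable Y P)
    (hK : 0 < K)
    (htail : ∀ t : ℝ, 0 < t → P.real {ω | t ≤ |Y ω|} ≤ 2 * Real.exp (-t ^ 2 / K ^ 2)) :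
    ∫⁻ ω, ENNReal.ofReal (Y ω ^ 4) ∂P ≤ ENNReal.ofReal (4 * K ^ 4) := by
  have hfour : ∀ ω, Y ω ^ 4 = |Y ω| ^ (4 : ℝ) := fun ω => by
    rw [← Even.pow_abs (by decide : Even 4)]
    norm_cast
  have hint : Integrable (fun t : ℝ => t ^ (3 : ℝ) * Real.exp (-t ^ 2 / K ^ 2))
      (volume.restrict (Set.Ioi 0)) :=
    .of_integral_ne_zero (by rw [integral_Ioi_cube_mul_exp_neg_sq_div hK]; positivity)
  calc ∫⁻ ω, ENNReal.ofReal (Y ω ^ 4) ∂P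
      = ENNReal.ofReal 4 * ∫⁻ t in Set.Ioi (0 : ℝ),
          P {ω | t ≤ |Y ω|} * ENNReal.ofReal (t ^ ((4 : ℝ) - 1)) := by
        simp_rw [hfour]
        exact lintegral_rpow_eq_lintegral_meas_le_mul P (ae_of_all _ fun ω => abs_nonneg _)
          hY.norm (by norm_num)
    _ ≤ ENNReal.ofReal 4 * ∫⁻ t in Set.Ioi (0 : ℝ),
          ENNReal.ofReal (2 * (t ^ (3 : ℝ) * Real.exp (-t ^ 2 / K ^ 2))) := by
        refine mul_le_mul_right (setLIntegral_mono' measurableSet_Ioi fun t ht => ?_) _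
        rw [← ofReal_measureReal (μ := P), ← ENNReal.ofReal_mul measureReal_nonneg]
        refine ENNReal.ofReal_le_ofReal ?_
        rw [show (4 : ℝ) - 1 = 3 by norm_num]
        have hpow : 0 ≤ t ^ (3 : ℝ) := Real.rpow_nonneg (le_of_lt ht) _
        linarith [mul_le_mul_of_nonneg_right (htail t ht) hpow]
    _ = ENNReal.ofReal (4 * K ^ 4) := by
        rw [← ofReal_integral_eq_lintegral_ofReal (hint.const_mul 2), integral_const_mul,
          integral_Ioi_cube_mul_exp_neg_sq_div hK, ← ENNReal.ofReal_mul (by norm_num)]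
        · congr 1
          ring
        · filter_upwards [self_mem_ae_restrict measurableSet_Ioi] with t ht
          have : (0 : ℝ) < t := ht
          simp only [Pi.zero_apply]
          positivity

theorem sq_le_mul_abs_add_pow_four {M : ℝ} (hM : 0 < M) (y : ℝ) :
    y ^ 2 ≤ M * |y| + y ^ 4 / M ^ 2 := by
  rw [← sq_abs y, ← Even.pow_abs (by decide : Even 4) y]
  have hy : 0 ≤ |y| := abs_nonneg y
  rcases le_total |y| M with hle | hle
  · have : 0 ≤ |y| ^ 4 / M ^ 2 := by positivity
    nlinarith
  · have hsq : |y| ^ 2 ≤ |y| ^ 4 / M ^ 2 := by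
      rw [le_div_iff₀ (by positivity)]
      nlinarith [sq_nonneg |y|, pow_le_pow_left₀ hM.le hle 2]
    have : 0 ≤ M * |y| := by positivity
    linarith

theorem integral_max_zero_of_integral_eq_zero (hY : Integrable Y P) (hmean : ∫ ω, Y ω ∂P = 0) :
    ∫ ω, max (Y ω) 0 ∂P = (∫ ω, |Y ω| ∂P) / 2 := by
  have hmax : ∀ y : ℝ, max y 0 = (|y| + y) / 2 := fun y => by
    rw [abs_add_eq_two_nsmul_posPart, posPart_def, two_nsmul, add_self_div_two]
  simp_rw [hmax]
  rw [integral_div, integral_add hY.abs hY, hmean, add_zero]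

theorem mul_sqrt_div_le_integral_max_zero (hY : Integrable Y P)
    (hY2 : Integrable (fun ω => Y ω ^ 2) P) (hY4 : Integrable (fun ω => Y ω ^ 4) P)
    (hmean : ∫ ω, Y ω ∂P = 0) (hσ : 0 < σ) (hvar : σ ≤ ∫ ω, Y ω ^ 2 ∂P) (hB : 1 ≤ B)
    (hfour : ∫ ω, Y ω ^ 4 ∂P ≤ B) :
    σ * √σ / (8 * B) ≤ ∫ ω, max (Y ω) 0 ∂P := by
  have hsqrt : 0 < √σ := Real.sqrt_pos.2 hσ
  have hB0 : 0 < B := one_pos.trans_le hB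
  set M := 2 * B / √σ with hM
  have hM2 : M ^ 2 = 4 * B ^ 2 / σ := by
    rw [hM, div_pow, Real.sq_sqrt hσ.le]
    ring
  have hsplit : ∫ ω, Y ω ^ 2 ∂P ≤ M * ∫ ω, |Y ω| ∂P + (∫ ω, Y ω ^ 4 ∂P) / M ^ 2 := by
    rw [← integral_const_mul, ← integral_div,
      ← integral_add (hY.abs.const_mul _) (hY4.div_const _)]
    exact integral_mono hY2 ((hY.abs.const_mul _).add (hY4.div_const _)) fun ω =>
      sq_le_mul_abs_add_pow_four (by positivity) (Y ω)
  have hfour' : (∫ ω, Y ω ^ 4 ∂P) / M ^ 2 ≤ σ / 4 := by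
    rw [hM2, div_div_eq_mul_div, div_le_div_iff₀ (by positivity) (by norm_num)]
    nlinarith [mul_le_mul_of_nonneg_right hfour hσ.le, mul_le_mul_of_nonneg_right hB hB0.le]
  have habs : σ / 2 ≤ M * ∫ ω, |Y ω| ∂P := by linarith
  rw [hM, div_mul_eq_mul_div, le_div_iff₀ hsqrt] at habs
  rw [integral_max_zero_of_integral_eq_zero hY hmean, div_le_div_iff₀ (by positivity) two_pos]
  linarith

theorem integral_max_zero_sub_le_setIntegral (hY : Integrable Y P) (hξ : Integrable ξ P)
    (hYm : Measurable Y) (hξm : Measurable ξ) :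
    ∫ ω, max (Y ω) 0 ∂P - ∫ ω, |ξ ω| ∂P ≤ ∫ ω in {ω | 0 ≤ Y ω + ξ ω}, Y ω ∂P := by
  have hS : MeasurableSet {ω | 0 ≤ Y ω + ξ ω} := measurableSet_le measurable_const (hYm.add hξm)
  rw [← integral_indicator hS, ← integral_sub hY.pos_part hξ.abs]
  refine integral_mono (hY.pos_part.sub hξ.abs) (hY.indicator hS) fun ω => ?_
  simp only [Set.indicator_apply, Set.mem_ofPred_eq]
  have hξ' := neg_abs_le (ξ ω)
  rcases max_cases (Y ω) 0 with ⟨hmax, _⟩ | ⟨hmax, _⟩ <;> rw [hmax] <;>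
    split_ifs with hω <;> linarith [le_abs_self (ξ ω), neg_le_abs (ξ ω), abs_nonneg (ξ ω)]

theorem measureReal_mul_sq_le_integral_sq [IsFiniteMeasure P]
    (hY2 : Integrable (fun ω => Y ω ^ 2) P) (hc : 0 < c) :
    P.real {ω | c ≤ Y ω} * c ^ 2 ≤ ∫ ω, Y ω ^ 2 ∂P := by
  refine le_trans ?_ (mul_meas_ge_le_integral_of_nonneg (ae_of_all _ fun ω => sq_nonneg _) hY2
    (c ^ 2))
  rw [mul_comm]
  refine mul_le_mul_of_nonneg_left (measureReal_mono fun ω hω => ?_) (sq_nonneg c)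
  exact pow_le_pow_left₀ hc.le hω 2

theorem mul_div_two_le_setIntegral [IsFiniteMeasure P] (hY : MemLp Y 2 P) (hYm : Measurable Y)
    (hξm : Measurable ξ) (hc : 0 < c) (hε : 0 < ε) (hlevel : ε ≤ P.real {ω | c ≤ Y ω})
    (hB : ∫ ω, Y ω ^ 2 ∂P ≤ B) (htail : P.real {ω | c / 2 ≤ |ξ ω|} ≤ c ^ 2 * ε ^ 2 / (16 * B)) :
    c * ε / 2 ≤ ∫ ω in {ω | c / 2 ≤ Y ω + ξ ω}, Y ω ∂P := by
  have hmarkov : ε * c ^ 2 ≤ B :=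
    (mul_le_mul_of_nonneg_right hlevel (sq_nonneg c)).trans
      ((measureReal_mul_sq_le_integral_sq hY.integrable_sq hc).trans hB)
  have hB0 : 0 < B := lt_of_lt_of_le (by positivity) hmarkov
  have hLevel : MeasurableSet {ω | c ≤ Y ω} := measurableSet_le measurable_const hYm
  have hTail : MeasurableSet {ω | c / 2 ≤ |ξ ω|} := measurableSet_le measurable_const hξm.abs
  have hS : MeasurableSet {ω | c / 2 ≤ Y ω + ξ ω} :=
    measurableSet_le measurable_const (hYm.add hξm)
  -- balances the two error terms, each `c * ε / 8`
  set κ := c * ε / (4 * B)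
  have hκ0 : 0 < κ := by positivity
  have hint1 := (integrable_const c (μ := P)).indicator hLevel
  have hint2 := (integrable_const (c + 1 / (2 * κ)) (μ := P)).indicator hTail
  have hint12 : Integrable (fun ω => {ω | c ≤ Y ω}.indicator (fun _ => c) ω -
      {ω | c / 2 ≤ |ξ ω|}.indicator (fun _ => c + 1 / (2 * κ)) ω) P := hint1.sub hint2
  calc c * ε / 2 ≤ ε * c - c ^ 2 * ε ^ 2 / (16 * B) * (c + 1 / (2 * κ)) - κ / 2 * B :=
        mul_div_two_le_sub_sub hc hε hmarkov
    _ ≤ P.real {ω | c ≤ Y ω} * c - P.real {ω | c / 2 ≤ |ξ ω|} * (c + 1 / (2 * κ)) -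
          κ / 2 * ∫ ω, Y ω ^ 2 ∂P := by gcongr
    _ = ∫ ω, ({ω | c ≤ Y ω}.indicator (fun _ => c) ω -
          {ω | c / 2 ≤ |ξ ω|}.indicator (fun _ => c + 1 / (2 * κ)) ω - κ / 2 * Y ω ^ 2) ∂P := by
        rw [integral_sub hint12 (hY.integrable_sq.const_mul _),
          integral_sub hint1 hint2, integral_const_mul, integral_indicator_const _ hLevel,
          integral_indicator_const _ hTail, smul_eq_mul, smul_eq_mul]
    _ ≤ ∫ ω, {ω | c / 2 ≤ Y ω + ξ ω}.indicator Y ω ∂P :=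
        integral_mono (hint12.sub (hY.integrable_sq.const_mul _))
          ((hY.integrable one_le_two).indicator hS)
          (indicator_sub_indicator_sub_sq_le_indicator hκ0 hc)
    _ = ∫ ω in {ω | c / 2 ≤ Y ω + ξ ω}, Y ω ∂P := integral_indicator hS

end RandomVariables

section FourthMoment

variable {E : Type*} [NormedAddCommGroup E] [InnerProductSpace ℝ E] [MeasurableSpace E]

/-- All one-dimensional marginals of `μ` in unit directions have fourth moment at most `B`. The
normalization `1 ≤ B` makes `B` a bound for the lower moments as well. -/
structure FourthMomentBound (μ : Measure E) (B : ℝ) : Prop where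
  one_le : 1 ≤ B
  integrable_four : ∀ v : E, ‖v‖ = 1 → Integrable (fun x => (inner ℝ v x : ℝ) ^ 4) μ
  four_le : ∀ v : E, ‖v‖ = 1 → ∫ x, (inner ℝ v x : ℝ) ^ 4 ∂μ ≤ B

namespace FourthMomentBound

variable {μ : Measure E} {B : ℝ}

theorem pos (h : FourthMomentBound μ B) : 0 < B := one_pos.trans_le h.one_le

variable [BorelSpace E] [FiniteDimensional ℝ E] [IsProbabilityMeasure μ] {v : E}

theorem memLp_two_inner (h : FourthMomentBound μ B) (hv : ‖v‖ = 1) :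
    MemLp (fun x => (inner ℝ v x : ℝ)) 2 μ := by
  refine (memLp_two_iff_integrable_sq (by fun_prop)).2 ?_
  refine (((integrable_const 1).add (h.integrable_four v hv)).div_const 2).mono' (by fun_prop)
    (ae_of_all _ fun x => ?_)
  rw [Real.norm_of_nonneg (sq_nonneg _)]
  simp only [Pi.add_apply]
  linarith [sq_nonneg ((inner ℝ v x : ℝ) ^ 2 - 1)]

theorem integrable_sq (h : FourthMomentBound μ B) (hv : ‖v‖ = 1) :
    Integrable (fun x => (inner ℝ v x : ℝ) ^ 2) μ := (h.memLp_two_inner hv).integrable_sq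

theorem two_le (h : FourthMomentBound μ B) (hv : ‖v‖ = 1) :
    ∫ x, (inner ℝ v x : ℝ) ^ 2 ∂μ ≤ B := by
  have hfour := h.integrable_four v hv
  calc ∫ x, (inner ℝ v x : ℝ) ^ 2 ∂μ ≤ ∫ x, (1 + (inner ℝ v x : ℝ) ^ 4) / 2 ∂μ :=
        integral_mono (h.integrable_sq hv) (((integrable_const 1).add hfour).div_const 2)
          fun x => by linarith [sq_nonneg ((inner ℝ v x : ℝ) ^ 2 - 1)]
    _ = (1 + ∫ x, (inner ℝ v x : ℝ) ^ 4 ∂μ) / 2 := by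
        rw [integral_div, integral_add (integrable_const 1) hfour, integral_const, probReal_univ,
          one_smul]
    _ ≤ B := by linarith [h.four_le v hv, h.one_le]

theorem integrable_id (h : FourthMomentBound μ B) : Integrable (fun x => x) μ := by
  let b := stdOrthonormalBasis ℝ E
  have hsum : Integrable (fun x => ∑ i, (inner ℝ (b i) x : ℝ) • b i) μ :=
    integrable_finsetSum _ fun i _ =>
      ((h.memLp_two_inner (b.norm_eq_one i)).integrable one_le_two).smul_const _
  simpa only [b.sum_repr'] using hsum

theorem integrable_inner (h : FourthMomentBound μ B) (v : E) :
    Integrable (fun x => (inner ℝ v x : ℝ)) μ :=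
  h.integrable_id.const_inner v

theorem integral_abs_inner_le (h : FourthMomentBound μ B) (hv : ‖v‖ = 1) :
    ∫ x, |(inner ℝ v x : ℝ)| ∂μ ≤ B := by
  have hsq := h.integrable_sq hv
  calc ∫ x, |(inner ℝ v x : ℝ)| ∂μ ≤ ∫ x, (1 + (inner ℝ v x : ℝ) ^ 2) / 2 ∂μ :=
        integral_mono (h.integrable_inner v).abs (((integrable_const 1).add hsq).div_const 2)
          fun x => by
            simp only [← sq_abs (inner ℝ v x)]
            linarith [sq_nonneg (|(inner ℝ v x : ℝ)| - 1)]
    _ = (1 + ∫ x, (inner ℝ v x : ℝ) ^ 2 ∂μ) / 2 := by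
        rw [integral_div, integral_add (integrable_const 1) hsq, integral_const, probReal_univ,
          one_smul]
    _ ≤ B := by linarith [h.two_le hv, h.one_le]

theorem norm_mean_le (h : FourthMomentBound μ B) : ‖∫ x, x ∂μ‖ ≤ B := by
  set m := ∫ x, x ∂μ
  rcases eq_or_ne m 0 with h0 | h0
  · rw [h0, norm_zero]
    exact h.pos.le
  calc ‖m‖ = inner ℝ (‖m‖⁻¹ • m) m := by
        rw [real_inner_smul_left, real_inner_self_eq_norm_mul_norm,
          inv_mul_cancel_left₀ (norm_ne_zero_iff.2 h0)]
    _ = ∫ x, (inner ℝ (‖m‖⁻¹ • m) x : ℝ) ∂μ := (integral_inner h.integrable_id _).symm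
    _ ≤ ∫ x, |(inner ℝ (‖m‖⁻¹ • m) x : ℝ)| ∂μ :=
        integral_mono (h.integrable_inner _) (h.integrable_inner _).abs fun x => le_abs_self _
    _ ≤ B := h.integral_abs_inner_le (norm_smul_inv_norm h0)

end FourthMomentBound

end FourthMoment

theorem PriorAssumption.fourthMomentBound {d : ℕ} {μ : Measure (EuclideanSpace ℝ (Fin d))}
    [IsProbabilityMeasure μ] {c ε σ K : ℝ} (h : PriorAssumption μ c ε σ K) :
    FourthMomentBound μ (1 + 4 * K ^ 4) := by
  have hpos : 0 ≤ 4 * K ^ 4 := by positivity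
  have hlint : ∀ v : EuclideanSpace ℝ (Fin d), ‖v‖ = 1 →
      ∫⁻ x, ENNReal.ofReal ((inner ℝ v x : ℝ) ^ 4) ∂μ ≤ ENNReal.ofReal (4 * K ^ 4) :=
    fun v hv => lintegral_pow_four_le_of_subgaussian_tail (by fun_prop) h.K_pos (h.subgaussian v hv)
  have hnonneg : ∀ v : EuclideanSpace ℝ (Fin d), 0 ≤ᵐ[μ] fun x => (inner ℝ v x : ℝ) ^ 4 :=
    fun v => ae_of_all _ fun x => by positivity
  refine ⟨by linarith, fun v hv => ?_, fun v hv => ?_⟩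
  · exact (lintegral_ofReal_ne_top_iff_integrable (by fun_prop) (hnonneg v)).1
      ((hlint v hv).trans_lt ENNReal.ofReal_lt_top).ne
  · rw [integral_eq_lintegral_of_nonneg_ae (hnonneg v) (by fun_prop)]
    linarith [ENNReal.toReal_le_of_le_ofReal hpos (hlint v hv)]

section Subgaussian

open scoped NNReal

variable {Ω Ω' : Type*} [MeasurableSpace Ω] [MeasurableSpace Ω'] {P : Measure Ω}

theorem hasSubgaussianMGF_prod_of_ae {P' : Measure Ω'} [IsProbabilityMeasure P]
    [SFinite P'] {X : Ω × Ω' → ℝ} {τ : ℝ≥0} (hX : AEStronglyMeasurable X (P.prod P'))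
    (h : ∀ᵐ z ∂P, HasSubgaussianMGF (fun w => X (z, w)) τ P') :
    HasSubgaussianMGF X τ (P.prod P') := by
  have hexp_meas : ∀ t : ℝ, AEStronglyMeasurable (fun q => Real.exp (t * X q)) (P.prod P') :=
    fun t => Real.continuous_exp.comp_aestronglyMeasurable (hX.const_mul t)
  have hbound : ∀ t : ℝ, ∀ᵐ z ∂P,
      ∫ w, Real.exp (t * X (z, w)) ∂P' ≤ Real.exp (τ * t ^ 2 / 2) := fun t => by
    filter_upwards [h] with z hz using hz.mgf_le t
  have hint : ∀ t : ℝ, Integrable (fun z => ∫ w, Real.exp (t * X (z, w)) ∂P') P := fun t => by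
    refine (integrable_const (Real.exp (τ * t ^ 2 / 2))).mono'
      (hexp_meas t).integral_prod_right' ?_
    filter_upwards [hbound t] with z hz
    rwa [Real.norm_of_nonneg (integral_nonneg fun w => (Real.exp_pos _).le)]
  have hexp_int : ∀ t : ℝ, Integrable (fun q => Real.exp (t * X q)) (P.prod P') := fun t => by
    refine (integrable_prod_iff (hexp_meas t)).2 ⟨?_, ?_⟩
    · filter_upwards [h] with z hz using hz.integrable_exp_mul t
    · simpa only [Real.norm_eq_abs, Real.abs_exp] using hint t
  refine ⟨hexp_int, fun t => ?_⟩
  rw [mgf, integral_prod _ (hexp_int t)]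
  simpa using integral_mono_ae (hint t) (integrable_const _) (hbound t)

variable {X : Ω → ℝ} {τ : ℝ≥0}

theorem measureReal_le_abs_le_of_hasSubgaussianMGF [IsFiniteMeasure P]
    (h : HasSubgaussianMGF X τ P) {x : ℝ} (hx : 0 ≤ x) :
    P.real {ω | x ≤ |X ω|} ≤ 2 * Real.exp (-x ^ 2 / (2 * τ)) := by
  have hset : {ω | x ≤ |X ω|} = {ω | x ≤ X ω} ∪ {ω | x ≤ (-X) ω} := by
    ext ω
    simp [le_abs]
  rw [hset, two_mul]
  exact (measureReal_union_le _ _).trans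
    (add_le_add (h.measure_ge_le hx) (h.neg.measure_ge_le hx))

theorem integral_abs_le_of_hasSubgaussianMGF [IsFiniteMeasure P] (h : HasSubgaussianMGF X τ P) :
    ∫ ω, |X ω| ∂P ≤ 2 * √τ := by
  rcases eq_or_ne τ 0 with rfl | hτ
  · have hzero : (fun ω => |X ω|) =ᵐ[P] 0 := by
      filter_upwards [h.ae_eq_zero_of_hasSubgaussianMGF_zero] with ω hω
      simp [hω]
    simp [integral_congr_ae hzero]
  have hs : 0 < √(τ : ℝ) := Real.sqrt_pos.2 (by positivity)
  set a := (√(τ : ℝ))⁻¹ with ha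
  have hcosh : ∀ y : ℝ, |y| ≤ √τ * ((Real.exp (a * y) + Real.exp (-a * y)) / 2) := fun y => by
    rw [← inv_mul_le_iff₀ hs, neg_mul, ← Real.cosh_eq, ← Real.cosh_abs, abs_mul,
      abs_of_pos (by positivity : 0 < a)]
    exact (Real.self_le_sinh_iff.2 (by positivity)).trans (Real.sinh_lt_cosh _).le
  have hmgf : ∀ t : ℝ, t ^ 2 = a ^ 2 → ∫ ω, Real.exp (t * X ω) ∂P ≤ 2 := fun t ht => by
    refine (h.mgf_le t).trans ((Real.le_log_iff_exp_le two_pos).1 ?_)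
    rw [ht, ha, inv_pow, Real.sq_sqrt (NNReal.coe_nonneg τ),
      mul_inv_cancel₀ (NNReal.coe_ne_zero.2 hτ)]
    linarith [Real.log_two_gt_d9]
  have hint := h.integrable_exp_mul a
  have hint' := h.integrable_exp_mul (-a)
  calc ∫ ω, |X ω| ∂P
      ≤ ∫ ω, √τ * ((Real.exp (a * X ω) + Real.exp (-a * X ω)) / 2) ∂P :=
        integral_mono h.integrable.abs (((hint.add hint').div_const 2).const_mul _) fun ω => hcosh _
    _ = √τ * ((∫ ω, Real.exp (a * X ω) ∂P + ∫ ω, Real.exp (-a * X ω) ∂P) / 2) := by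
        rw [integral_const_mul, integral_div, integral_add hint hint']
    _ ≤ 2 * √τ := by
        rw [mul_comm]
        gcongr
        linarith [hmgf a rfl, hmgf (-a) (neg_sq a)]

/-- The law of the sequence of reward noises. -/
noncomputable abbrev noiseLaw : Measure (ℕ → ℝ) :=
  Measure.infinitePi (fun _ : ℕ => gaussianReal 0 1)

theorem hasSubgaussianMGF_id_gaussianReal : HasSubgaussianMGF id 1 (gaussianReal 0 1) :=
  ⟨fun t => integrable_exp_mul_gaussianReal t, fun t => by simp [mgf_id_gaussianReal]⟩

theorem hasSubgaussianMGF_sum_noise {b : ℕ → ℝ} {T : ℕ}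
    (h : ∑ t ∈ Finset.range T, b t ^ 2 ≤ τ) :
    HasSubgaussianMGF (fun w : ℕ → ℝ => ∑ t ∈ Finset.range T, w t * b t) τ noiseLaw := by
  have hcoord : ∀ t : ℕ, HasSubgaussianMGF (fun w : ℕ → ℝ => w t) 1 noiseLaw := fun t => by
    refine (HasSubgaussianMGF.id_map_iff (measurable_pi_apply t).aemeasurable).1 ?_
    rw [Measure.infinitePi_map_eval (fun _ : ℕ => gaussianReal 0 1) t]
    exact hasSubgaussianMGF_id_gaussianReal
  have hindep : iIndepFun (fun (t : ℕ) (w : ℕ → ℝ) => b t * w t) noiseLaw :=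
    iIndepFun_infinitePi (X := fun t x => b t * x) (by fun_prop)
  have hsum := HasSubgaussianMGF.sum_of_iIndepFun hindep (s := Finset.range T)
    (c := fun t => ⟨b t ^ 2, sq_nonneg _⟩ * 1) fun t _ => (hcoord t).const_mul (b t)
  simp_rw [mul_comm _ (b _)]
  refine ⟨hsum.integrable_exp_mul, fun t => (hsum.mgf_le t).trans ?_⟩
  gcongr
  rw [← NNReal.coe_le_coe, NNReal.coe_sum]
  exact (Finset.sum_congr rfl fun t _ => mul_one (b t ^ 2)).trans_le h

end Subgaussian

section Support

variable {F : Type*} [NormedAddCommGroup F] [InnerProductSpace ℝ F]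

theorem ball_subset_closure_of_convex_of_support [CompleteSpace F] {s : Set F} (hs : Convex ℝ s)
    (hne : s.Nonempty) {r : ℝ} (h : ∀ v : F, ‖v‖ = 1 → ∃ x ∈ s, r ≤ inner ℝ v x) :
    Metric.ball 0 r ⊆ closure s := by
  intro u hu
  by_contra hnot
  obtain ⟨f, c, hfs, hfu⟩ := geometric_hahn_banach_closed_point hs.closure isClosed_closure hnot
  obtain ⟨y, rfl⟩ := (InnerProductSpace.toDual ℝ F).surjective f
  simp only [InnerProductSpace.toDual_apply_apply] at hfs hfu
  have hy : y ≠ 0 := by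
    rintro rfl
    obtain ⟨x, hx⟩ := hne
    have hlt := (hfs x (subset_closure hx)).trans hfu
    simp only [inner_zero_left, lt_self_iff_false] at hlt
  have hnorm : 0 < ‖y‖ := norm_pos_iff.2 hy
  obtain ⟨x, hx, hrx⟩ := h (‖y‖⁻¹ • y) (norm_smul_inv_norm hy)
  rw [real_inner_smul_left, inv_mul_eq_div, le_div_iff₀ hnorm] at hrx
  have hu' : ‖u‖ < r := mem_ball_zero_iff.1 hu
  nlinarith [hfs x (subset_closure hx), real_inner_le_norm y u]

theorem interior_closure_eq_interior_of_convex {V : Type*} [NormedAddCommGroup V]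
    [NormedSpace ℝ V] [FiniteDimensional ℝ V] {s : Set V} (hs : Convex ℝ s)
    (h : (interior (closure s)).Nonempty) : interior (closure s) = interior s := by
  refine hs.interior_closure_eq_interior_of_nonempty_interior ?_
  rw [hs.interior_nonempty_iff_affineSpan_eq_top, eq_top_iff,
    ← hs.closure.interior_nonempty_iff_affineSpan_eq_top.1 h, affineSpan_le]
  exact closure_minimal (subset_affineSpan ℝ s)
    (AffineSubspace.closed_of_finiteDimensional (affineSpan ℝ s))

theorem ball_subset_of_convex_of_support [FiniteDimensional ℝ F] {s : Set F} (hs : Convex ℝ s)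
    (hne : s.Nonempty) {r : ℝ} (hr : 0 < r) (h : ∀ v : F, ‖v‖ = 1 → ∃ x ∈ s, r ≤ inner ℝ v x) :
    Metric.ball 0 r ⊆ s := by
  have hball : Metric.ball 0 r ⊆ interior (closure s) :=
    interior_maximal (ball_subset_closure_of_convex_of_support hs hne h) Metric.isOpen_ball
  rw [interior_closure_eq_interior_of_convex hs ⟨0, hball (Metric.mem_ball_self hr)⟩] at hball
  exact hball.trans interior_subset

end Support

section Randomization

variable {Ω : Type*} [MeasurableSpace Ω] {P : Measure Ω} {F : Type*} [NormedAddCommGroup F]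

theorem integrable_smul_of_mem_Icc [NormedSpace ℝ F] {f : Ω → F} {ψ : Ω → ℝ} (hf : Integrable f P)
    (hψ : Measurable ψ) (h : ∀ ω, ψ ω ∈ Set.Icc (0 : ℝ) 1) : Integrable (fun ω => ψ ω • f ω) P :=
  hf.bdd_smul 1 hψ.aestronglyMeasurable <| ae_of_all _ fun ω => by
    rw [Real.norm_eq_abs, abs_of_nonneg (h ω).1]
    exact (h ω).2

theorem exists_weight_integral_eq [InnerProductSpace ℝ F] [FiniteDimensional ℝ F] {β : Type*}
    [MeasurableSpace β] {f : Ω → F} {X : Ω → β} (hf : Integrable f P) (hX : Measurable X)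
    {R : ℝ} (hR : 0 < R)
    (h : ∀ v : F, ‖v‖ = 1 →
      ∃ H : Set β, MeasurableSet H ∧ R ≤ ∫ ω in X ⁻¹' H, inner ℝ v (f ω) ∂P)
    {u : F} (hu : ‖u‖ < R) :
    ∃ ψ : β → ℝ, Measurable ψ ∧ (∀ x, ψ x ∈ Set.Icc (0 : ℝ) 1) ∧
      ∫ ω, ψ (X ω) • f ω ∂P = u := by
  let s : Set F := {y | ∃ ψ : β → ℝ, Measurable ψ ∧ (∀ x, ψ x ∈ Set.Icc (0 : ℝ) 1) ∧
    ∫ ω, ψ (X ω) • f ω ∂P = y}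
  have hconvex : Convex ℝ s := by
    rintro _ ⟨ψ, hψ, hψI, rfl⟩ _ ⟨ψ', hψ', hψI', rfl⟩ a b ha hb hab
    refine ⟨fun x => a * ψ x + b * ψ' x, (hψ.const_mul a).add (hψ'.const_mul b), fun x =>
      convex_Icc (0 : ℝ) 1 (hψI x) (hψI' x) ha hb hab, ?_⟩
    have hint := integrable_smul_of_mem_Icc hf (hψ.comp hX) fun ω => hψI (X ω)
    have hint' := integrable_smul_of_mem_Icc hf (hψ'.comp hX) fun ω => hψI' (X ω)
    simp only [Function.comp_apply] at hint hint'
    simp only [add_smul, mul_smul]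
    rw [← integral_smul, ← integral_smul]
    exact integral_add (hint.smul a) (hint'.smul b)
  refine ball_subset_of_convex_of_support hconvex
    ⟨0, fun _ => 0, measurable_const, fun _ => ⟨le_rfl, zero_le_one⟩, by simp⟩ hR (fun v hv => ?_)
    (mem_ball_zero_iff.2 hu)
  obtain ⟨H, hH, hRH⟩ := h v hv
  refine ⟨∫ ω in X ⁻¹' H, f ω ∂P, ⟨H.indicator 1, measurable_one.indicator hH, fun x =>
    ⟨Set.indicator_nonneg (fun _ _ => zero_le_one) x,
      Set.indicator_le_self' (fun _ _ => zero_le_one) x⟩, ?_⟩, ?_⟩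
  · rw [← integral_indicator (hX hH)]
    refine integral_congr_ae (ae_of_all _ fun ω => ?_)
    by_cases hω : X ω ∈ H <;> simp [hω]
  · rwa [← integral_inner hf.restrict]

theorem volume_real_setOf_coe_le {x : ℝ} (hx : x ∈ Set.Icc (0 : ℝ) 1) :
    (volume : Measure unitInterval).real {z | (z : ℝ) ≤ x} = x := by
  rw [show {z : unitInterval | (z : ℝ) ≤ x} = Set.Iic ⟨x, hx⟩ from rfl, measureReal_def,
    unitInterval.volume_Iic, ENNReal.toReal_ofReal hx.1]

theorem setIntegral_coe_le_eq_integral_smul [NormedSpace ℝ F] [CompleteSpace F] [SFinite P]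
    {f : Ω → F} {ψ : Ω → ℝ} (hf : Integrable f P) (hψ : Measurable ψ)
    (h : ∀ ω, ψ ω ∈ Set.Icc (0 : ℝ) 1) :
    ∫ x in {x : Ω × unitInterval | (x.2 : ℝ) ≤ ψ x.1}, f x.1 ∂(P.prod volume) =
      ∫ ω, ψ ω • f ω ∂P := by
  have hmeas : MeasurableSet {x : Ω × unitInterval | (x.2 : ℝ) ≤ ψ x.1} :=
    measurableSet_le (measurable_subtype_coe.comp measurable_snd) (hψ.comp measurable_fst)
  rw [← integral_indicator hmeas, integral_prod _ ((hf.comp_fst _).indicator hmeas)]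
  refine integral_congr_ae (ae_of_all _ fun ω => ?_)
  have hind : ∀ z : unitInterval, {x : Ω × unitInterval | (x.2 : ℝ) ≤ ψ x.1}.indicator
      (fun x => f x.1) (ω, z) = {z : unitInterval | (z : ℝ) ≤ ψ ω}.indicator (fun _ => f ω) z :=
    fun _ => rfl
  simp only [hind]
  rw [integral_indicator (measurableSet_le measurable_subtype_coe measurable_const),
    setIntegral_const, volume_real_setOf_coe_le (h ω)]

end Randomization

section Orthogonal

variable {E : Type*} [NormedAddCommGroup E] [InnerProductSpace ℝ E] {V : Submodule ℝ E} {b : E}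

theorem starProjection_sup_span_singleton_of_mem_orthogonal [V.HasOrthogonalProjection]
    [(V ⊔ ℝ ∙ b).HasOrthogonalProjection] (hb : ‖b‖ = 1) (hbV : b ∈ Vᗮ) (x : E) :
    (V ⊔ ℝ ∙ b).starProjection x = V.starProjection x + inner ℝ b x • b := by
  refine Submodule.eq_starProjection_of_mem_orthogonal ?_ ?_
  · exact Submodule.add_mem_sup (Submodule.starProjection_apply_mem V x)
      (Submodule.smul_mem _ _ (Submodule.mem_span_singleton_self b))
  · rw [← Submodule.inf_orthogonal, sub_add_eq_sub_sub]
    refine ⟨Vᗮ.sub_mem (V.sub_starProjection_mem_orthogonal x) (Vᗮ.smul_mem _ hbV),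
      Submodule.mem_orthogonal_singleton_iff_inner_right.2 ?_⟩
    rw [inner_sub_right, inner_sub_right, real_inner_smul_right, real_inner_self_eq_norm_sq, hb,
      Submodule.inner_left_of_mem_orthogonal (Submodule.starProjection_apply_mem V x) hbV]
    ring

theorem norm_starProjection_sup_span_singleton_sq [V.HasOrthogonalProjection]
    [(V ⊔ ℝ ∙ b).HasOrthogonalProjection] (hb : ‖b‖ = 1) (hbV : b ∈ Vᗮ) (x : E) :
    ‖(V ⊔ ℝ ∙ b).starProjection x‖ ^ 2 = ‖V.starProjection x‖ ^ 2 + inner ℝ b x ^ 2 := by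
  have hortho : inner ℝ (V.starProjection x) (inner ℝ b x • b) = 0 :=
    Submodule.inner_right_of_mem_orthogonal (Submodule.starProjection_apply_mem V x)
      (Vᗮ.smul_mem _ hbV)
  rw [starProjection_sup_span_singleton_of_mem_orthogonal hb hbV, norm_add_sq_real, hortho,
    norm_smul, hb, mul_one, Real.norm_eq_abs, sq_abs, mul_zero, add_zero]

theorem finrank_sup_span_singleton_of_mem_orthogonal [FiniteDimensional ℝ V] (hb : b ≠ 0)
    (hbV : b ∈ Vᗮ) :
    Module.finrank ℝ (V ⊔ ℝ ∙ b : Submodule ℝ E) = Module.finrank ℝ V + 1 := by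
  have hdisj : V ⊓ ℝ ∙ b = ⊥ := disjoint_iff.1 <|
    V.orthogonal_disjoint.mono_right ((Submodule.span_singleton_le_iff_mem b Vᗮ).2 hbV)
  have hrank := Submodule.finrank_sup_add_finrank_inf_eq V (ℝ ∙ b)
  rwa [hdisj, finrank_bot, add_zero, finrank_span_singleton hb] at hrank

theorem exists_norm_eq_one_mem_orthogonal [V.HasOrthogonalProjection] (hV : V ≠ ⊤) :
    ∃ b ∈ Vᗮ, ‖b‖ = 1 := by
  obtain ⟨x, hx, hx0⟩ := Submodule.exists_mem_ne_zero_of_ne_bot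
    (mt Submodule.orthogonal_eq_bot_iff.1 hV)
  exact ⟨‖x‖⁻¹ • x, Vᗮ.smul_mem _ hx, norm_smul_inv_norm hx0⟩

theorem eq_inner_smul_add_of_starProjection_orthogonal_eq [CompleteSpace E] {m v w : E}
    (hv : ‖v‖ = 1) (h : (ℝ ∙ v)ᗮ.starProjection m = w) : m = inner ℝ v m • v + w := by
  rw [← h, ← Submodule.starProjection_unit_singleton ℝ hv,
    Submodule.starProjection_add_starProjection_orthogonal]

theorem induction_finrank_of_orthogonal_step [FiniteDimensional ℝ E]
    {motive : ℕ → Submodule ℝ E → Prop} {v : E} (hv : v ≠ 0) (zero : motive 0 (ℝ ∙ v))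
    (step : ∀ k V, v ∈ V → V ≠ ⊤ → motive k V →
      ∃ b ∈ Vᗮ, b ≠ 0 ∧ motive (k + 1) (V ⊔ ℝ ∙ b)) :
    motive (Module.finrank ℝ E - 1) ⊤ := by
  have reach : ∀ k < Module.finrank ℝ E, ∃ V : Submodule ℝ E,
      v ∈ V ∧ Module.finrank ℝ V = k + 1 ∧ motive k V := by
    intro k
    induction k with
    | zero =>
      exact fun _ => ⟨ℝ ∙ v, Submodule.mem_span_singleton_self v, finrank_span_singleton hv, zero⟩
    | succ k ih =>
      intro hk
      obtain ⟨V, hvV, hrank, hV⟩ := ih (Nat.lt_of_succ_lt hk)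
      have hVtop : V ≠ ⊤ := by
        rintro rfl
        exact hk.ne (hrank.symm.trans (finrank_top ℝ E))
      obtain ⟨b, hbV, hb, hstep⟩ := step k V hvV hVtop hV
      exact ⟨V ⊔ ℝ ∙ b, Submodule.mem_sup_left hvV,
        by rw [finrank_sup_span_singleton_of_mem_orthogonal hb hbV, hrank], hstep⟩
  have hpos : 0 < Module.finrank ℝ E := Module.finrank_pos_iff_exists_ne_zero.2 ⟨v, hv⟩
  obtain ⟨V, -, hrank, hV⟩ := reach (Module.finrank ℝ E - 1) (Nat.sub_one_lt hpos.ne')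
  rwa [Submodule.eq_top_of_finrank_eq (hrank.trans (Nat.sub_add_cancel hpos))] at hV

end Orthogonal

theorem posSemidef_sum_vecMulVec_sub_smul_one {ι n : Type*} [Fintype n] [DecidableEq n]
    {s : Finset ι} {a : ι → EuclideanSpace ℝ n} {lam : ℝ}
    (h : ∀ v : EuclideanSpace ℝ n, lam * ‖v‖ ^ 2 ≤ ∑ i ∈ s, inner ℝ (a i) v ^ 2) :
    ((∑ i ∈ s, Matrix.vecMulVec (a i).ofLp (a i).ofLp) -
      lam • (1 : Matrix n n ℝ)).PosSemidef := by
  refine Matrix.PosSemidef.of_dotProduct_mulVec_nonneg ?_ fun x => ?_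
  · refine Matrix.IsHermitian.sub ?_ (by simp [Matrix.IsHermitian])
    rw [Matrix.IsHermitian, Matrix.conjTranspose_sum]
    exact Finset.sum_congr rfl fun i _ => by simp
  have hterm : ∀ i, x ⬝ᵥ (Matrix.vecMulVec (a i).ofLp (a i).ofLp).mulVec x =
      inner ℝ (a i) (WithLp.toLp 2 x) ^ 2 := fun i => by
    rw [EuclideanSpace.inner_eq_star_dotProduct, Matrix.vecMulVec_mulVec]
    simp [dotProduct_comm, sq]
  have hnorm : x ⬝ᵥ x = ‖(WithLp.toLp 2 x : EuclideanSpace ℝ n)‖ ^ 2 := by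
    rw [EuclideanSpace.norm_sq_eq]
    simp [dotProduct, sq]
  simp only [star_trivial, Matrix.sub_mulVec, Matrix.smul_mulVec, Matrix.one_mulVec,
    Matrix.sum_mulVec, dotProduct_sub, dotProduct_sum, dotProduct_smul, smul_eq_mul, hterm, hnorm,
    sub_nonneg]
  exact h _

theorem exists_norm_eq_one_eq_smul {E : Type*} [NormedAddCommGroup E] [NormedSpace ℝ E] {x e : E}
    (he : ‖e‖ = 1) : ∃ a : E, ‖a‖ = 1 ∧ x = ‖x‖ • a := by
  rcases eq_or_ne x 0 with rfl | hx
  · exact ⟨e, he, by rw [norm_zero, zero_smul]⟩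
  · exact ⟨‖x‖⁻¹ • x, norm_smul_inv_norm hx, (smul_inv_smul₀ (norm_ne_zero_iff.2 hx) x).symm⟩

/-! ### Policies and linear estimators -/

/-- A bandit algorithm whose seed is a pair of independent uniform variables. The exploration
schedule depends on the first component; the second one randomizes recommendations. -/
structure Policy (d : ℕ) where
  horizon : ℕ
  act : (t : ℕ) → unitInterval × unitInterval → (Fin t → ℝ) → EuclideanSpace ℝ (Fin d)
  norm_act_le : ∀ t s h, ‖act t s h‖ ≤ 1
  measurable_act : ∀ t,
    Measurable (fun q : (unitInterval × unitInterval) × (Fin t → ℝ) => act t q.1 q.2)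

/-- The sample points of a policy: parameter, seed and noises. -/
abbrev Sample (d : ℕ) : Type :=
  EuclideanSpace ℝ (Fin d) × (unitInterval × unitInterval) × (ℕ → ℝ)

/-- The law of a sample point when the prior is `μ`. -/
noncomputable abbrev sampleLaw {d : ℕ} (μ : Measure (EuclideanSpace ℝ (Fin d))) :
    Measure (Sample d) :=
  μ.prod (((volume : Measure unitInterval).prod volume).prod noiseLaw)

namespace Policy

variable {d : ℕ}

/-- The bandit algorithm of a policy. -/
noncomputable abbrev toAlg (p : Policy d) : BanditAlgorithm d where
  Seed := unitInterval × unitInterval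
  seedLaw := (volume : Measure unitInterval).prod volume
  horizon := p.horizon
  act := p.act
  norm_act_le := p.norm_act_le
  measurable_act := p.measurable_act

/-- The action of round `t`, as a function on the common sample space of all policies. -/
noncomputable def action (p : Policy d) (t : ℕ) (ω : Sample d) : EuclideanSpace ℝ (Fin d) :=
  p.toAlg.action t ω

/-- The rewards of the first `T` rounds. -/
noncomputable def history (p : Policy d) (T : ℕ) (ω : Sample d) : Fin T → ℝ :=
  fun i => p.toAlg.reward ω i

/-- What is known to the principal at the horizon: the seed and the rewards. -/
abbrev Observation (p : Policy d) : Type :=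
  (unitInterval × unitInterval) × (Fin p.horizon → ℝ)

/-- The observation made by the policy at a sample point. -/
noncomputable def observe (p : Policy d) (ω : Sample d) : p.Observation :=
  (ω.2.1, p.history p.horizon ω)

theorem action_eq (p : Policy d) (t : ℕ) (ω : Sample d) :
    p.action t ω = p.act t ω.2.1 (p.history t ω) := rfl

theorem history_apply (p : Policy d) {T : ℕ} (ω : Sample d) (i : Fin T) :
    p.history T ω i = inner ℝ (p.action i ω) ω.1 + ω.2.2 i :=
  p.toAlg.reward_eq ω i

theorem measurable_observe (p : Policy d) : Measurable p.observe :=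
  measurable_snd.fst.prodMk (measurable_pi_lambda _ fun i => p.toAlg.measurable_reward i)

open scoped Classical in
/-- Continue a policy for `n` rounds by playing `a` on the observable event `G` and `a'` off `G`. -/
noncomputable def extend (p : Policy d) (n : ℕ) {G : Set p.Observation} (hG : MeasurableSet G)
    {a a' : EuclideanSpace ℝ (Fin d)} (ha : ‖a‖ = 1) (ha' : ‖a'‖ = 1) : Policy d where
  horizon := p.horizon + n
  act t s h := if ht : t < p.horizon then p.act t s h
    else if (s, fun i => h (Fin.castLE (not_lt.1 ht) i)) ∈ G then a else a'
  norm_act_le t s h := by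
    split_ifs
    · exact p.norm_act_le t s h
    · exact ha.le
    · exact ha'.le
  measurable_act t := by
    by_cases ht : t < p.horizon
    · simpa only [ht, dite_true] using p.measurable_act t
    · simp only [ht, dite_false]
      refine Measurable.ite ?_ measurable_const measurable_const
      refine (measurable_fst.prodMk (measurable_pi_lambda _ fun i => ?_)) hG
      exact (measurable_pi_apply _).comp measurable_snd

section Extend

variable (p : Policy d) (n : ℕ) {G : Set p.Observation} (hG : MeasurableSet G)
  {a a' : EuclideanSpace ℝ (Fin d)} (ha : ‖a‖ = 1) (ha' : ‖a'‖ = 1) {t : ℕ}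

theorem extend_action_of_lt (ht : t < p.horizon) (ω : Sample d) :
    (p.extend n hG ha ha').action t ω = p.action t ω := by
  induction t using Nat.strong_induction_on with
  | _ t ih =>
    have hhistory : (p.extend n hG ha ha').history t ω = p.history t ω := by
      funext i
      rw [history_apply, history_apply, ih i i.2 (i.2.trans ht)]
    rw [action_eq, action_eq, hhistory]
    simp only [extend, ht, dite_true]

open scoped Classical in
theorem extend_action_of_le (ht : p.horizon ≤ t) (ω : Sample d) :
    (p.extend n hG ha ha').action t ω = if ω ∈ p.observe ⁻¹' G then a else a' := by
  have hhistory : (fun i : Fin p.horizon =>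
      (p.extend n hG ha ha').history t ω (Fin.castLE ht i)) = p.history p.horizon ω := by
    funext i
    rw [history_apply, history_apply, Fin.val_castLE, extend_action_of_lt _ _ _ _ _ i.2]
  rw [action_eq, Set.mem_preimage, observe, ← hhistory]
  simp only [extend, not_lt.2 ht, dite_false]
  rfl

end Extend

/-- The policy `p'` continues `p`. -/
structure Extends (p p' : Policy d) : Prop where
  horizon_le : p.horizon ≤ p'.horizon
  action_eq : ∀ t < p.horizon, ∀ ω, p'.action t ω = p.action t ω

theorem Extends.refl (p : Policy d) : p.Extends p := ⟨le_rfl, fun _ _ _ => rfl⟩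

theorem Extends.trans {p p' p'' : Policy d} (h : p.Extends p') (h' : p'.Extends p'') :
    p.Extends p'' :=
  ⟨h.horizon_le.trans h'.horizon_le, fun t ht ω =>
    (h'.action_eq t (ht.trans_le h.horizon_le) ω).trans (h.action_eq t ht ω)⟩

variable {μ : Measure (EuclideanSpace ℝ (Fin d))}

theorem exists_extends_block (hμ : Integrable (fun x => x) μ) {p : Policy d}
    (hp : p.toAlg.IsFinitelyBIC μ) (n : ℕ) {G : Set p.Observation} (hG : MeasurableSet G)
    {a : EuclideanSpace ℝ (Fin d)} (ha : ‖a‖ = 1) {r : ℝ} (hr : 0 ≤ r)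
    (hint : ∫ ω in p.observe ⁻¹' G, ω.1 ∂(sampleLaw μ) = r • a) :
    ∃ p' : Policy d, p'.toAlg.IsFinitelyBIC μ ∧ p.Extends p' ∧ p'.horizon = p.horizon + n ∧
      ∀ t, p.horizon ≤ t → ∀ ω, p.observe ω ∈ G → p'.action t ω = a := by
  classical
  obtain ⟨a', ha', hint'⟩ := exists_norm_eq_one_eq_smul
    (x := ∫ ω in (p.observe ⁻¹' G)ᶜ, ω.1 ∂(sampleLaw μ)) ha
  have hlt : ∀ t < p.horizon, (p.extend n hG ha ha').action t = p.action t := fun t ht =>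
    funext (p.extend_action_of_lt n hG ha ha' ht)
  have hle : ∀ t, p.horizon ≤ t → (p.extend n hG ha ha').action t =
      fun ω => if ω ∈ p.observe ⁻¹' G then a else a' := fun t ht =>
    funext (p.extend_action_of_le n hG ha ha' ht)
  refine ⟨p.extend n hG ha ha', fun t _ => ?_, ⟨Nat.le_add_right _ _, fun t ht ω => ?_⟩, rfl,
    fun t ht ω hω => ?_⟩
  · change HasAlignedLevelSets (sampleLaw μ) (fun ω => ω.1) ((p.extend n hG ha ha').action t)
    rcases lt_or_ge t p.horizon with ht | ht
    · rw [hlt t ht]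
      exact hp t ht
    · rw [hle t ht]
      exact HasAlignedLevelSets.ite (hμ.comp_fst _) (p.measurable_observe hG) ha ha' hr
        (norm_nonneg _) hint hint'
  · rw [hlt t ht]
  · rw [hle t ht]
    exact if_pos hω

theorem exists_extends_const [IsProbabilityMeasure μ] (hμ : Integrable (fun x => x) μ)
    {p : Policy d} (hp : p.toAlg.IsFinitelyBIC μ) (n : ℕ) {a : EuclideanSpace ℝ (Fin d)}
    (ha : ‖a‖ = 1) {r : ℝ} (hr : 0 ≤ r) (hmean : ∫ x, x ∂μ = r • a) :
    ∃ p' : Policy d, p'.toAlg.IsFinitelyBIC μ ∧ p.Extends p' ∧ p'.horizon = p.horizon + n ∧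
      ∀ t, p.horizon ≤ t → ∀ ω, p'.action t ω = a := by
  have hint : ∫ ω in p.observe ⁻¹' Set.univ, ω.1 ∂(sampleLaw μ) = r • a := by
    rw [Set.preimage_univ, setIntegral_univ, ← hmean]
    exact (integral_fun_fst fun x : EuclideanSpace ℝ (Fin d) => x).trans (by simp)
  obtain ⟨p', hp', hext, hhor, hact⟩ :=
    exists_extends_block hμ hp n MeasurableSet.univ ha hr hint
  exact ⟨p', hp', hext, hhor, fun t ht ω => hact t ht ω trivial⟩

end Policy

namespace Policy

variable {d : ℕ}

/-- The vectors `e t z`, functions of the exploration seed `z`, are the weights of a linear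
estimator `∑ t, r t • e t z` of the projection of the parameter to `V`, which is unbiased with
covariance at most `τ` whenever `z ∈ D`. -/
structure IsLinearEstimator (p : Policy d) (D : Set unitInterval)
    (V : Submodule ℝ (EuclideanSpace ℝ (Fin d))) (τ : NNReal)
    (e : ℕ → unitInterval → EuclideanSpace ℝ (Fin d)) : Prop where
  measurable : ∀ t, Measurable (e t)
  unbiased : ∀ ω : Sample d, ω.2.1.1 ∈ D → ∀ x,
    ∑ t ∈ Finset.range p.horizon, (inner ℝ (p.action t ω) x : ℝ) • e t ω.2.1.1 = V.starProjection x
  sum_sq_le : ∀ z ∈ D, ∀ v,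
    ∑ t ∈ Finset.range p.horizon, inner ℝ (e t z) v ^ 2 ≤ τ * ‖V.starProjection v‖ ^ 2

/-- On the seeds in `D`, the rewards of `p` determine the projection of the parameter to `V` up to
noise of covariance at most `τ`. -/
def Informed (p : Policy d) (D : Set unitInterval) (V : Submodule ℝ (EuclideanSpace ℝ (Fin d)))
    (τ : NNReal) : Prop :=
  ∃ e, p.IsLinearEstimator D V τ e

theorem IsLinearEstimator.append {p p' : Policy d} {D : Set unitInterval}
    {V V' : Submodule ℝ (EuclideanSpace ℝ (Fin d))} {τ : NNReal}
    {e f : ℕ → unitInterval → EuclideanSpace ℝ (Fin d)} (h : p.IsLinearEstimator D V τ e)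
    (hp : p.Extends p') {n : ℕ} (hn : p'.horizon = p.horizon + n) (hf : ∀ i, Measurable (f i))
    (hsum : ∀ ω : Sample d, ω.2.1.1 ∈ D → ∀ x, ∑ i ∈ Finset.range n,
      (inner ℝ (p'.action (p.horizon + i) ω) x : ℝ) • f i ω.2.1.1 =
        V'.starProjection x - V.starProjection x)
    (hsq : ∀ z ∈ D, ∀ v, ∑ i ∈ Finset.range n, inner ℝ (f i z) v ^ 2 ≤
      τ * (‖V'.starProjection v‖ ^ 2 - ‖V.starProjection v‖ ^ 2)) :
    p'.IsLinearEstimator D V' τ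
      fun t z => if t < p.horizon then e t z else f (t - p.horizon) z := by
  refine ⟨fun t => ?_, fun ω hω x => ?_, fun z hz v => ?_⟩
  · by_cases ht : t < p.horizon
    · simpa only [ht, if_true] using h.measurable t
    · simpa only [ht, if_false] using hf _
  · rw [hn, Finset.sum_range_add, Finset.sum_congr rfl fun t ht => by
      rw [if_pos (Finset.mem_range.1 ht), hp.action_eq t (Finset.mem_range.1 ht)], h.unbiased ω hω]
    simp only [add_lt_iff_neg_left, not_lt_zero, if_false, add_tsub_cancel_left, hsum ω hω,
      add_sub_cancel]
  · rw [hn, Finset.sum_range_add, Finset.sum_congr rfl fun t ht => by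
      rw [if_pos (Finset.mem_range.1 ht)]]
    simp only [add_lt_iff_neg_left, not_lt_zero, if_false, add_tsub_cancel_left]
    linarith [h.sum_sq_le z hz v, hsq z hz v]

namespace Informed

variable {p p' : Policy d} {D D' : Set unitInterval}
  {V V' : Submodule ℝ (EuclideanSpace ℝ (Fin d))} {τ : NNReal}

theorem mono_set (h : p.Informed D V τ) (hD : D' ⊆ D) : p.Informed D' V τ := by
  obtain ⟨e, he⟩ := h
  exact ⟨e, he.measurable, fun ω hω => he.unbiased ω (hD hω), fun z hz => he.sum_sq_le z (hD hz)⟩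

theorem mono_space (h : p.Informed D V τ) (hV : V' ≤ V) : p.Informed D V' τ := by
  obtain ⟨e, he⟩ := h
  have hproj : ∀ x, V'.starProjection (V.starProjection x) = V'.starProjection x := fun x =>
    DFunLike.congr_fun (Submodule.starProjection_comp_starProjection_of_le hV) x
  have hproj' : ∀ v, V.starProjection (V'.starProjection v) = V'.starProjection v := fun v =>
    Submodule.starProjection_eq_self_iff.2 (hV (Submodule.starProjection_apply_mem V' v))
  refine ⟨fun t z => V'.starProjection (e t z),
    fun t => V'.starProjection.continuous.measurable.comp (he.measurable t), fun ω hω x => ?_,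
    fun z hz v => ?_⟩
  · simp only [← map_smul, ← map_sum, he.unbiased ω hω, hproj]
  · simpa only [Submodule.inner_starProjection_left_eq_right, hproj'] using
      he.sum_sq_le z hz (V'.starProjection v)

theorem mono_covariance {τ' : NNReal} (h : p.Informed D V τ) (hτ : τ ≤ τ') :
    p.Informed D V τ' := by
  obtain ⟨e, he⟩ := h
  exact ⟨e, he.measurable, he.unbiased, fun z hz v => (he.sum_sq_le z hz v).trans (by gcongr)⟩

theorem of_extends (h : p.Informed D V τ) (hp : p.Extends p') : p'.Informed D V τ := by
  obtain ⟨e, he⟩ := h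
  obtain ⟨n, hn⟩ := Nat.exists_eq_add_of_le hp.horizon_le
  exact ⟨_, he.append hp hn (f := 0) (fun _ => measurable_const) (by simp) (by simp)⟩

theorem union (h : p.Informed D V τ) (h' : p.Informed D' V τ) (hD : MeasurableSet D) :
    p.Informed (D ∪ D') V τ := by
  classical
  obtain ⟨e, he⟩ := h
  obtain ⟨e', he'⟩ := h'
  refine ⟨fun t z => if z ∈ D then e t z else e' t z,
    fun t => Measurable.ite hD (he.measurable t) (he'.measurable t), fun ω hω x => ?_,
    fun z hz v => ?_⟩
  · by_cases hωD : ω.2.1.1 ∈ D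
    · simpa only [hωD, if_true] using he.unbiased ω hωD x
    · simpa only [hωD, if_false] using he'.unbiased ω (hω.resolve_left hωD) x
  · by_cases hzD : z ∈ D
    · simpa only [hzD, if_true] using he.sum_sq_le z hzD v
    · simpa only [hzD, if_false] using he'.sum_sq_le z (hz.resolve_left hzD) v

theorem span_singleton {a : EuclideanSpace ℝ (Fin d)} (ha : ‖a‖ = 1) (hn : 0 < p.horizon)
    (hτ : (p.horizon : ℝ)⁻¹ ≤ τ) (hact : ∀ t < p.horizon, ∀ ω, p.action t ω = a) :
    p.Informed Set.univ (ℝ ∙ a) τ := by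
  have hn' : (p.horizon : ℝ) ≠ 0 := by exact_mod_cast hn.ne'
  refine ⟨fun _ _ => (p.horizon : ℝ)⁻¹ • a, fun _ => measurable_const, fun ω _ x => ?_,
    fun z _ v => ?_⟩
  · rw [Finset.sum_congr rfl fun t ht => by rw [hact t (Finset.mem_range.1 ht)], Finset.sum_const,
      Finset.card_range, Submodule.starProjection_unit_singleton ℝ ha, ← Nat.cast_smul_eq_nsmul ℝ,
      smul_smul, smul_smul]
    congr 1
    field_simp
  · rw [Submodule.starProjection_unit_singleton ℝ ha, norm_smul, ha, mul_one, Real.norm_eq_abs,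
      sq_abs, Finset.sum_const, Finset.card_range, nsmul_eq_mul, real_inner_smul_left]
    calc (p.horizon : ℝ) * ((p.horizon : ℝ)⁻¹ * inner ℝ a v) ^ 2
        = (p.horizon : ℝ)⁻¹ * inner ℝ a v ^ 2 := by field_simp
      _ ≤ τ * inner ℝ a v ^ 2 := by gcongr

theorem sup_span_singleton (h : p.Informed D V τ) (hp : p.Extends p') {n : ℕ} (hn : 0 < n)
    (hhor : p'.horizon = p.horizon + (n + n)) {v₁ a b : EuclideanSpace ℝ (Fin d)} {κ ζ : ℝ}
    (hb : ‖b‖ = 1) (hbV : b ∈ Vᗮ) (ha : a = κ • v₁ + ζ • b) (hζ : ζ ≠ 0)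
    (hτ : (1 + κ ^ 2) / (n * ζ ^ 2) ≤ τ)
    (hact : ∀ i < n, ∀ ω : Sample d, ω.2.1.1 ∈ D → p'.action (p.horizon + i) ω = a)
    (hact' : ∀ i < n, ∀ ω : Sample d, ω.2.1.1 ∈ D → p'.action (p.horizon + (n + i)) ω = v₁) :
    p'.Informed D (V ⊔ ℝ ∙ b) τ := by
  obtain ⟨e, he⟩ := h
  have hn' : (n : ℝ) ≠ 0 := by exact_mod_cast hn.ne'
  -- `⟪b, x⟫ = (⟪a, x⟫ - κ ⟪v₁, x⟫) / ζ` is estimated from the averages of the two blocks.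
  refine ⟨_, he.append hp hhor
    (f := fun i _ => if i < n then (ζ * n)⁻¹ • b else (-(κ * (ζ * n)⁻¹)) • b)
    (fun _ => measurable_const) (fun ω hω x => ?_) fun z _ v => ?_⟩
  · have hfirst : ∀ i ∈ Finset.range n, (inner ℝ (p'.action (p.horizon + i) ω) x : ℝ) •
        (if i < n then (ζ * n)⁻¹ • b else (-(κ * (ζ * n)⁻¹)) • b) =
          inner ℝ a x • (ζ * n)⁻¹ • b := fun i hi => by
      rw [hact i (Finset.mem_range.1 hi) ω hω, if_pos (Finset.mem_range.1 hi)]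
    have hsecond : ∀ i ∈ Finset.range n, (inner ℝ (p'.action (p.horizon + (n + i)) ω) x : ℝ) •
        (if n + i < n then (ζ * n)⁻¹ • b else (-(κ * (ζ * n)⁻¹)) • b) =
          inner ℝ v₁ x • (-(κ * (ζ * n)⁻¹)) • b := fun i hi => by
      rw [hact' i (Finset.mem_range.1 hi) ω hω, if_neg (by lia)]
    rw [Finset.sum_range_add, Finset.sum_congr rfl hfirst, Finset.sum_congr rfl hsecond,
      starProjection_sup_span_singleton_of_mem_orthogonal hb hbV, add_sub_cancel_left, ha]
    simp only [Finset.sum_const, Finset.card_range,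
      ← Nat.cast_smul_eq_nsmul ℝ, smul_smul, ← add_smul, inner_add_left, real_inner_smul_left]
    congr 1
    field_simp
    ring
  · rw [Finset.sum_range_add,
      Finset.sum_congr rfl fun i hi => by rw [if_pos (Finset.mem_range.1 hi)],
      norm_starProjection_sup_span_singleton_sq hb hbV, add_sub_cancel_left]
    simp only [add_lt_iff_neg_left, not_lt_zero, if_false, Finset.sum_const, Finset.card_range,
      nsmul_eq_mul, real_inner_smul_left]
    calc (n : ℝ) * ((ζ * n)⁻¹ * inner ℝ b v) ^ 2 + n * (-(κ * (ζ * n)⁻¹) * inner ℝ b v) ^ 2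
        = (1 + κ ^ 2) / (n * ζ ^ 2) * inner ℝ b v ^ 2 := by
          field_simp
      _ ≤ τ * inner ℝ b v ^ 2 := by gcongr

theorem spectrallyExplores (h : p.Informed Set.univ ⊤ τ) (hτ : 0 < τ)
    {μ : Measure (EuclideanSpace ℝ (Fin d))} : p.toAlg.SpectrallyExplores μ (τ : ℝ)⁻¹ := by
  obtain ⟨e, he⟩ := h
  refine ae_of_all _ fun ω => posSemidef_sum_vecMulVec_sub_smul_one fun v => ?_
  change (τ : ℝ)⁻¹ * ‖v‖ ^ 2 ≤ ∑ t ∈ Finset.range p.horizon, inner ℝ (p.action t ω) v ^ 2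
  have hunbiased : ∑ t ∈ Finset.range p.horizon,
      (inner ℝ (p.action t ω) v : ℝ) * inner ℝ (e t ω.2.1.1) v = ‖v‖ ^ 2 := by
    simpa only [sum_inner, real_inner_smul_left, Submodule.starProjection_top,
      ContinuousLinearMap.id_apply, real_inner_self_eq_norm_sq]
      using congrArg (fun x => inner ℝ x v) (he.unbiased ω trivial v)
  have hcauchy := Finset.sum_mul_sq_le_sq_mul_sq (Finset.range p.horizon)
    (fun t => inner ℝ (p.action t ω) v) fun t => inner ℝ (e t ω.2.1.1) v
  have hvar := he.sum_sq_le ω.2.1.1 trivial v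
  rw [Submodule.starProjection_top, ContinuousLinearMap.id_apply] at hvar
  have hnonneg : 0 ≤ ∑ t ∈ Finset.range p.horizon, inner ℝ (p.action t ω) v ^ 2 :=
    Finset.sum_nonneg fun t _ => sq_nonneg _
  rw [hunbiased] at hcauchy
  rcases eq_or_ne v 0 with rfl | hv
  · simp
  · have hv2 : 0 < ‖v‖ ^ 2 := by positivity
    refine (inv_mul_le_iff₀ (by exact_mod_cast hτ)).2 (le_of_mul_le_mul_right ?_ hv2)
    calc ‖v‖ ^ 2 * ‖v‖ ^ 2 ≤ (∑ t ∈ Finset.range p.horizon, inner ℝ (p.action t ω) v ^ 2) *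
          (τ * ‖v‖ ^ 2) := by
          rw [← sq]; exact hcauchy.trans (mul_le_mul_of_nonneg_left hvar hnonneg)
      _ = _ := by ring

end Informed

end Policy

/-! ### Steering the mean -/

theorem measure_ne_zero_of_norm_lt_mul {α E : Type*} [MeasurableSpace α] [NormedAddCommGroup E]
    {P : Measure α} {D : Set α} {u : E} {R : ℝ} (h : ‖u‖ < P.real D * R) : P D ≠ 0 := fun hD =>
  (norm_nonneg u).not_gt (by simpa [measureReal_def, hD] using h)

theorem measurePreserving_prod_rotate {α β γ δ : Type*} [MeasurableSpace α] [MeasurableSpace β]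
    [MeasurableSpace γ] [MeasurableSpace δ] (μ : Measure α) (ν : Measure β) (ρ : Measure γ)
    (π : Measure δ) [SFinite μ] [SFinite ν] [SFinite ρ] [SFinite π] :
    MeasurePreserving (fun x : α × (β × γ) × δ => ((x.1, x.2.1.1, x.2.2), x.2.1.2))
      (μ.prod ((ν.prod ρ).prod π)) ((μ.prod (ν.prod π)).prod ρ) := by
  have hswap : MeasurePreserving (fun x : (β × γ) × δ => ((x.1.1, x.2), x.1.2))
      ((ν.prod ρ).prod π) ((ν.prod π).prod ρ) :=
    ((measurePreserving_prodAssoc _ _ _).symm MeasurableEquiv.prodAssoc).comp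
      (((MeasurePreserving.id ν).prod Measure.measurePreserving_swap).comp
        (measurePreserving_prodAssoc _ _ _))
  exact ((measurePreserving_prodAssoc _ _ _).symm MeasurableEquiv.prodAssoc).comp
    ((MeasurePreserving.id μ).prod hswap)

/-- The part of a sample point that does not involve the recommendation seed: parameter,
exploration seed and noises. -/
abbrev CoreSample (d : ℕ) : Type :=
  EuclideanSpace ℝ (Fin d) × unitInterval × (ℕ → ℝ)

/-- The law of `CoreSample d` conditioned on the exploration seed being in `D`. -/
noncomputable abbrev coreLaw {d : ℕ} (μ : Measure (EuclideanSpace ℝ (Fin d)))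
    (D : Set unitInterval) : Measure (CoreSample d) :=
  μ.prod ((volume[|D]).prod noiseLaw)

/-- The projection of the parameter to `V`, perturbed by the noise of the estimator with
weights `e` based on `T` rounds. -/
noncomputable def estimate {d : ℕ} (T : ℕ) (V : Submodule ℝ (EuclideanSpace ℝ (Fin d)))
    (e : ℕ → unitInterval → EuclideanSpace ℝ (Fin d)) (q : CoreSample d) :
    EuclideanSpace ℝ (Fin d) :=
  V.starProjection q.1 + ∑ t ∈ Finset.range T, q.2.2 t • e t q.2.1

theorem inner_estimate_of_mem {d T : ℕ} {V : Submodule ℝ (EuclideanSpace ℝ (Fin d))}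
    {e : ℕ → unitInterval → EuclideanSpace ℝ (Fin d)} {v : EuclideanSpace ℝ (Fin d)} (hv : v ∈ V)
    (q : CoreSample d) :
    inner ℝ v (estimate T V e q) =
      inner ℝ v q.1 + ∑ t ∈ Finset.range T, q.2.2 t * inner ℝ (e t q.2.1) v := by
  rw [estimate, inner_add_right, ← Submodule.inner_starProjection_left_eq_right,
    Submodule.starProjection_eq_self_iff.2 hv, inner_sum]
  simp only [real_inner_smul_right, real_inner_comm]

namespace Policy

variable {d : ℕ}

/-- The linear estimator with weights `e`, computed from the observed rewards. -/
noncomputable def estimator (p : Policy d) (e : ℕ → unitInterval → EuclideanSpace ℝ (Fin d))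
    (q : p.Observation) : EuclideanSpace ℝ (Fin d) :=
  ∑ i, q.2 i • e i q.1.1

variable {p : Policy d} {D : Set unitInterval} {V : Submodule ℝ (EuclideanSpace ℝ (Fin d))}
  {τ : NNReal} {e : ℕ → unitInterval → EuclideanSpace ℝ (Fin d)}

namespace IsLinearEstimator

theorem measurable_estimator (he : p.IsLinearEstimator D V τ e) : Measurable (p.estimator e) :=
  Finset.measurable_sum _ fun i _ => ((measurable_pi_apply i).comp measurable_snd).smul
    ((he.measurable i).comp measurable_fst.fst)

theorem measurable_estimate (he : p.IsLinearEstimator D V τ e) (T : ℕ) :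
    Measurable (estimate T V e) :=
  (V.starProjection.continuous.measurable.comp measurable_fst).add <|
    Finset.measurable_sum _ fun t _ => ((measurable_pi_apply t).comp measurable_snd.snd).smul
      ((he.measurable t).comp measurable_snd.fst)

theorem estimator_observe (he : p.IsLinearEstimator D V τ e) {ω : Sample d} (hω : ω.2.1.1 ∈ D) :
    p.estimator e (p.observe ω) = estimate p.horizon V e (ω.1, ω.2.1.1, ω.2.2) := by
  rw [estimate, ← he.unbiased ω hω, ← Finset.sum_add_distrib, ← Fin.sum_univ_eq_sum_range
    (fun t => (inner ℝ (p.action t ω) ω.1 : ℝ) • e t ω.2.1.1 + ω.2.2 t • e t ω.2.1.1)]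
  simp only [estimator, observe, history_apply, add_smul]

end IsLinearEstimator

variable {μ : Measure (EuclideanSpace ℝ (Fin d))} [IsProbabilityMeasure μ]

theorem sampleLaw_restrict_seed :
    (sampleLaw μ).restrict {ω | ω.2.1.1 ∈ D} =
      μ.prod ((((volume : Measure unitInterval).restrict D).prod volume).prod noiseLaw) := by
  have hset : {ω : Sample d | ω.2.1.1 ∈ D} = Set.univ ×ˢ ((D ×ˢ Set.univ) ×ˢ Set.univ) := by
    ext ω
    simp
  rw [hset, sampleLaw, ← Measure.prod_restrict, ← Measure.prod_restrict, ← Measure.prod_restrict,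
    Measure.restrict_univ, Measure.restrict_univ, Measure.restrict_univ]

theorem setIntegral_seed_mem {F : Type*} [NormedAddCommGroup F] [NormedSpace ℝ F]
    (f : EuclideanSpace ℝ (Fin d) → F) :
    ∫ ω in {ω : Sample d | ω.2.1.1 ∈ D}, f ω.1 ∂(sampleLaw μ) =
      (volume : Measure unitInterval).real D • ∫ x, f x ∂μ := by
  rw [sampleLaw_restrict_seed, integral_fun_fst f]
  simp [measureReal_def, ← Set.univ_prod_univ, Measure.prod_prod]

theorem measurePreserving_restrict_seed (hD : volume D ≠ 0) :
    MeasurePreserving (fun ω : Sample d => ((ω.1, ω.2.1.1, ω.2.2), ω.2.1.2))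
      ((sampleLaw μ).restrict {ω | ω.2.1.1 ∈ D}) (volume D • (coreLaw μ D).prod volume) := by
  have hcond : (volume : Measure unitInterval).restrict D = volume D • volume[|D] := by
    rw [ProbabilityTheory.cond, smul_smul, ENNReal.mul_inv_cancel hD (measure_ne_top _ _),
      one_smul]
  rw [sampleLaw_restrict_seed, ← Measure.prod_smul_left, coreLaw, ← Measure.prod_smul_right,
    ← Measure.prod_smul_left, ← hcond]
  exact measurePreserving_prod_rotate _ _ _ _

theorem IsLinearEstimator.setIntegral_observe_preimage (hμ : Integrable (fun x => x) μ)
    (he : p.IsLinearEstimator D V τ e) (hD : volume D ≠ 0)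
    {ψ : EuclideanSpace ℝ (Fin d) → ℝ} (hψ : Measurable ψ)
    (hψI : ∀ x, ψ x ∈ Set.Icc (0 : ℝ) 1) :
    ∫ ω in p.observe ⁻¹' {q | q.1.1 ∈ D ∧ (q.1.2 : ℝ) ≤ ψ (p.estimator e q)}, ω.1 ∂(sampleLaw μ) =
      (volume : Measure unitInterval).real D •
        ∫ q, ψ (estimate p.horizon V e q) • q.1 ∂(coreLaw μ D) := by
  have : IsProbabilityMeasure (volume[|D]) := cond_isProbabilityMeasure hD
  have hψm := hψ.comp (he.measurable_estimate p.horizon)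
  let S : Set (CoreSample d × unitInterval) := {x | (x.2 : ℝ) ≤ ψ (estimate p.horizon V e x.1)}
  have hS : MeasurableSet S :=
    measurableSet_le (measurable_subtype_coe.comp measurable_snd) (hψm.comp measurable_fst)
  have hevent : p.observe ⁻¹' {q | q.1.1 ∈ D ∧ (q.1.2 : ℝ) ≤ ψ (p.estimator e q)} =
      (fun ω : Sample d => ((ω.1, ω.2.1.1, ω.2.2), ω.2.1.2)) ⁻¹' S ∩ {ω | ω.2.1.1 ∈ D} := by
    ext ω
    refine (and_congr_right fun hω => ?_).trans and_comm
    change (ω.2.1.2 : ℝ) ≤ ψ (p.estimator e (p.observe ω)) ↔ _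
    rw [he.estimator_observe hω]
    rfl
  have hmp := measurePreserving_restrict_seed (μ := μ) hD
  rw [hevent, ← Measure.restrict_restrict (hmp.measurable hS),
    ← setIntegral_map (g := fun ω : Sample d => ((ω.1, ω.2.1.1, ω.2.2), ω.2.1.2))
      (f := fun x : CoreSample d × unitInterval => x.1.1) hS
      measurable_fst.fst.aestronglyMeasurable hmp.measurable.aemeasurable, hmp.map_eq,
    Measure.restrict_smul, integral_smul_measure]
  exact congrArg _ (setIntegral_coe_le_eq_integral_smul (hμ.comp_fst _) hψm fun q => hψI _)

/-- The observable events `G`, contained in the event that the exploration seed is in `D`, can be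
chosen such that the projection of `E[ℓ; G]` to `V` is that of `u`. -/
def Steers (p : Policy d) (μ : Measure (EuclideanSpace ℝ (Fin d))) (D : Set unitInterval)
    (V : Submodule ℝ (EuclideanSpace ℝ (Fin d))) (u : EuclideanSpace ℝ (Fin d)) : Prop :=
  ∃ G : Set p.Observation, MeasurableSet G ∧ (∀ q ∈ G, q.1.1 ∈ D) ∧
    V.starProjection (∫ ω in p.observe ⁻¹' G, ω.1 ∂(sampleLaw μ)) = V.starProjection u

theorem IsLinearEstimator.steers (hμ : Integrable (fun x => x) μ)
    (he : p.IsLinearEstimator D V τ e) (hDm : MeasurableSet D) {R : ℝ} (hR : 0 < R)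
    (h : ∀ v ∈ V, ‖v‖ = 1 → ∃ θ : ℝ, R ≤
      ∫ q in {q | θ ≤ inner ℝ v (estimate p.horizon V e q)}, inner ℝ v q.1 ∂(coreLaw μ D))
    {u : EuclideanSpace ℝ (Fin d)} (hu : ‖u‖ < (volume : Measure unitInterval).real D * R) :
    p.Steers μ D V u := by
  have hD := measure_ne_zero_of_norm_lt_mul hu
  have hδ : (volume : Measure unitInterval).real D ≠ 0 := (measureReal_ne_zero_iff).2 hD
  have : IsProbabilityMeasure (volume[|D]) := cond_isProbabilityMeasure hD
  have hint : Integrable (fun q : CoreSample d => q.1) (coreLaw μ D) := hμ.comp_fst _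
  obtain ⟨ψ, hψ, hψI, hψu⟩ := exists_weight_integral_eq (P := coreLaw μ D)
    (f := fun q : CoreSample d => V.orthogonalProjectionOnto q.1)
    (u := ((volume : Measure unitInterval).real D)⁻¹ • V.orthogonalProjectionOnto u)
    (V.orthogonalProjectionOnto.integrable_comp hint) (he.measurable_estimate p.horizon) hR
    (fun v hv => by
      obtain ⟨θ, hθ⟩ := h v v.2 hv
      refine ⟨{y | θ ≤ inner ℝ (v : EuclideanSpace ℝ (Fin d)) y},
        measurableSet_le measurable_const (by fun_prop), ?_⟩
      simpa only [Set.preimage_ofPred_eq, Submodule.inner_orthogonalProjectionOnto_eq_of_mem_left]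
        using hθ)
    (by
      rw [norm_smul, Real.norm_of_nonneg (by positivity),
        inv_mul_lt_iff₀ (measureReal_nonneg.lt_of_ne' hδ)]
      exact (V.norm_orthogonalProjectionOnto_apply_le u).trans_lt hu)
  have hψint : Integrable (fun q => ψ (estimate p.horizon V e q) • q.1) (coreLaw μ D) :=
    integrable_smul_of_mem_Icc hint (hψ.comp (he.measurable_estimate _)) fun q => hψI _
  refine ⟨{q | q.1.1 ∈ D ∧ (q.1.2 : ℝ) ≤ ψ (p.estimator e q)}, ?_, fun q hq => hq.1, ?_⟩
  · exact (measurable_fst.fst hDm).inter (measurableSet_le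
      (measurable_subtype_coe.comp measurable_fst.snd) (hψ.comp he.measurable_estimator))
  · rw [he.setIntegral_observe_preimage hμ hD hψ hψI, map_smul, Submodule.starProjection_apply,
      Submodule.starProjection_apply, ← V.orthogonalProjectionOnto.integral_comp_comm hψint]
    simp only [map_smul]
    rw [hψu, Submodule.coe_smul, smul_inv_smul₀ hδ]

theorem IsLinearEstimator.hasSubgaussianMGF_noise [IsProbabilityMeasure (volume[|D])]
    (he : p.IsLinearEstimator D V τ e) (hD : MeasurableSet D) {v : EuclideanSpace ℝ (Fin d)}
    (hv : ‖v‖ = 1) :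
    HasSubgaussianMGF
      (fun q : CoreSample d => ∑ t ∈ Finset.range p.horizon, q.2.2 t * inner ℝ (e t q.2.1) v) τ
      (coreLaw μ D) := by
  have hmeas := he.measurable
  refine hasSubgaussianMGF_prod_of_ae
    (Measurable.aestronglyMeasurable (by fun_prop)) (ae_of_all _ fun _ => ?_)
  refine hasSubgaussianMGF_prod_of_ae (Measurable.aestronglyMeasurable (by fun_prop)) ?_
  filter_upwards [ae_cond_mem hD] with z hz
  refine hasSubgaussianMGF_sum_noise ((he.sum_sq_le z hz v).trans
    (mul_le_of_le_one_right τ.coe_nonneg (pow_le_one₀ (norm_nonneg _) ?_)))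
  exact (V.norm_starProjection_apply_le v).trans_eq hv

namespace Informed

variable {B : ℝ} {u : EuclideanSpace ℝ (Fin d)}

theorem steers_of_halfspace (h : p.Informed D V τ) (hD : MeasurableSet D)
    (hM : FourthMomentBound μ B) {c ε : ℝ} (hc : 0 < c) (hε : 0 < ε)
    (hhalf : ∀ v : EuclideanSpace ℝ (Fin d), ‖v‖ = 1 → ε ≤ μ.real {x | c ≤ inner ℝ v x})
    (hτ : 2 * Real.exp (-c ^ 2 / (8 * τ)) ≤ c ^ 2 * ε ^ 2 / (16 * B))
    (hu : ‖u‖ < (volume : Measure unitInterval).real D * (c * ε / 2)) : p.Steers μ D V u := by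
  obtain ⟨e, he⟩ := h
  have hmeas := he.measurable
  refine he.steers hM.integrable_id hD (by positivity) (fun v hvV hv => ⟨c / 2, ?_⟩) hu
  have : IsProbabilityMeasure (volume[|D]) :=
    cond_isProbabilityMeasure (measure_ne_zero_of_norm_lt_mul hu)
  simp only [inner_estimate_of_mem hvV]
  have hfst : MeasurePreserving Prod.fst (coreLaw μ D) μ := measurePreserving_fst
  have hlevel : ε ≤ (coreLaw μ D).real {q | c ≤ inner ℝ v q.1} :=
    (hhalf v hv).trans_eq (hfst.measureReal_preimage
      (measurableSet_le measurable_const (by fun_prop)).nullMeasurableSet).symm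
  have htail := measureReal_le_abs_le_of_hasSubgaussianMGF
    (he.hasSubgaussianMGF_noise (μ := μ) hD hv) (half_pos hc).le
  refine mul_div_two_le_setIntegral (Y := fun q : CoreSample d => inner ℝ v q.1) (B := B)
    ((hM.memLp_two_inner hv).comp_measurePreserving hfst) (by fun_prop) (by fun_prop)
    hc hε hlevel ?_ ?_
  · exact (integral_fun_fst fun x : EuclideanSpace ℝ (Fin d) => (inner ℝ v x : ℝ) ^ 2).trans_le
      (by simpa using hM.two_le hv)
  · refine htail.trans (le_of_eq_of_le ?_ hτ)
    congr 2
    ring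

theorem steers_of_variance (h : p.Informed D V τ) (hD : MeasurableSet D)
    (hM : FourthMomentBound μ B) {σ : ℝ} (hσ : 0 < σ)
    (hvar : ∀ v : EuclideanSpace ℝ (Fin d), ‖v‖ = 1 → σ ≤ variance (fun x => inner ℝ v x) μ)
    (hmean : ∫ x, x ∂μ ∈ Vᗮ) (hτ : 2 * √τ ≤ σ * √σ / (16 * B))
    (hu : ‖u‖ < (volume : Measure unitInterval).real D * (σ * √σ / (16 * B))) :
    p.Steers μ D V u := by
  obtain ⟨e, he⟩ := h
  have hmeas := he.measurable
  have hB := hM.pos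
  refine he.steers hM.integrable_id hD (by positivity) (fun v hvV hv => ⟨0, ?_⟩) hu
  have : IsProbabilityMeasure (volume[|D]) :=
    cond_isProbabilityMeasure (measure_ne_zero_of_norm_lt_mul hu)
  simp only [inner_estimate_of_mem hvV]
  have hmeanv : ∫ x, (inner ℝ v x : ℝ) ∂μ = 0 := by
    rw [integral_inner hM.integrable_id, Submodule.inner_right_of_mem_orthogonal hvV hmean]
  have hpos : σ * √σ / (8 * B) ≤ ∫ x, max (inner ℝ v x : ℝ) 0 ∂μ := by
    refine mul_sqrt_div_le_integral_max_zero (hM.integrable_inner v) (hM.integrable_sq hv)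
      (hM.integrable_four v hv) hmeanv hσ ?_ hM.one_le (hM.four_le v hv)
    exact (hvar v hv).trans_eq (variance_of_integral_eq_zero (by fun_prop) hmeanv)
  have hnoise := he.hasSubgaussianMGF_noise (μ := μ) hD hv
  have habs := integral_abs_le_of_hasSubgaussianMGF hnoise
  have hsteer := integral_max_zero_sub_le_setIntegral
    (Y := fun q : CoreSample d => (inner ℝ v q.1 : ℝ)) (P := coreLaw μ D)
    ((hM.integrable_inner v).comp_fst _) hnoise.integrable (by fun_prop) (by fun_prop)
  have hfst := integral_fun_fst (μ := μ) (ν := (volume[|D]).prod noiseLaw)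
    fun x : EuclideanSpace ℝ (Fin d) => max (inner ℝ v x : ℝ) 0
  rw [probReal_univ, one_smul] at hfst
  refine le_trans ?_ hsteer
  rw [hfst]
  have hhalves : σ * √σ / (8 * B) = σ * √σ / (16 * B) + σ * √σ / (16 * B) := by
    field_simp
    ring
  linarith

end Informed

end Policy

/-! ### Exploration phases -/

/-- The exploration seeds at most `γ`, an event of probability `γ` when `0 ≤ γ ≤ 1`. -/
def lowSeeds (γ : ℝ) : Set unitInterval := {z | (z : ℝ) ≤ γ}

theorem lowSeeds_mono {α β : ℝ} (h : α ≤ β) : lowSeeds α ⊆ lowSeeds β := fun _ hz => hz.trans h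

theorem lowSeeds_one : lowSeeds 1 = Set.univ := Set.eq_univ_of_forall fun z => z.2.2

theorem measurableSet_lowSeeds (γ : ℝ) : MeasurableSet (lowSeeds γ) :=
  measurableSet_le measurable_subtype_coe measurable_const

theorem volume_real_lowSeeds {γ : ℝ} (hγ : γ ∈ Set.Icc (0 : ℝ) 1) :
    (volume : Measure unitInterval).real (lowSeeds γ) = γ :=
  volume_real_setOf_coe_le hγ

theorem volume_real_lowSeeds_diff {α β : ℝ} (hα : 0 ≤ α) (hαβ : α ≤ β) (hβ : β ≤ 1) :
    (volume : Measure unitInterval).real (lowSeeds β \ lowSeeds α) = β - α := by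
  rw [measureReal_sdiff (lowSeeds_mono hαβ) (measurableSet_lowSeeds α),
    volume_real_lowSeeds ⟨hα.trans hαβ, hβ⟩, volume_real_lowSeeds ⟨hα, hαβ.trans hβ⟩]

/-- The unit vector `v` points in the direction of the mean of `μ`. When the mean vanishes, every
unit vector does. -/
structure IsMeanDirection {d : ℕ} (μ : Measure (EuclideanSpace ℝ (Fin d)))
    (v : EuclideanSpace ℝ (Fin d)) : Prop where
  norm_eq_one : ‖v‖ = 1
  integral_eq : ∫ x, x ∂μ = ‖∫ x, x ∂μ‖ • v

theorem exists_isMeanDirection {d : ℕ} (hd : 0 < d) (μ : Measure (EuclideanSpace ℝ (Fin d))) :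
    ∃ v, IsMeanDirection μ v := by
  obtain ⟨v, hv, heq⟩ := exists_norm_eq_one_eq_smul (x := ∫ x, x ∂μ)
    (e := EuclideanSpace.single (⟨0, hd⟩ : Fin d) (1 : ℝ)) (by simp)
  exact ⟨v, hv, heq⟩

namespace Policy

variable {d : ℕ} {μ : Measure (EuclideanSpace ℝ (Fin d))} [IsProbabilityMeasure μ] {p : Policy d}
  {D D₀ : Set unitInterval} {V : Submodule ℝ (EuclideanSpace ℝ (Fin d))}

theorem Steers.exists_superset {u : EuclideanSpace ℝ (Fin d)} (h : p.Steers μ D V u)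
    (hμ : Integrable (fun x => x) μ) (hD₀ : MeasurableSet D₀) (hdisj : Disjoint D D₀) :
    ∃ G : Set p.Observation, MeasurableSet G ∧ (∀ q, q.1.1 ∈ D₀ → q ∈ G) ∧
      (∀ q ∈ G, q.1.1 ∈ D ∪ D₀) ∧
      V.starProjection (∫ ω in p.observe ⁻¹' G, ω.1 ∂(sampleLaw μ)) =
        V.starProjection (u + (volume : Measure unitInterval).real D₀ • ∫ x, x ∂μ) := by
  obtain ⟨G, hG, hGD, hint⟩ := h
  have hG₀ : MeasurableSet {q : p.Observation | q.1.1 ∈ D₀} := measurable_fst.fst hD₀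
  refine ⟨G ∪ {q | q.1.1 ∈ D₀}, hG.union hG₀, fun q hq => Or.inr hq,
    fun q hq => hq.imp_left (hGD q), ?_⟩
  have hdisj' : Disjoint G {q : p.Observation | q.1.1 ∈ D₀} :=
    Set.disjoint_left.2 fun q hq => Set.disjoint_left.1 hdisj (hGD q hq)
  have hsample : Integrable (fun ω : Sample d => ω.1) (sampleLaw μ) := hμ.comp_fst _
  rw [Set.preimage_union, setIntegral_union (hdisj'.preimage _) (p.measurable_observe hG₀)
    hsample.integrableOn hsample.integrableOn, map_add, hint, map_add]
  exact congrArg (fun x => _ + V.starProjection x) (setIntegral_seed_mem fun x => x)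

theorem abs_inner_setIntegral_observe_le {B : ℝ} (hM : FourthMomentBound μ B)
    {G : Set p.Observation} (hGD : ∀ q ∈ G, q.1.1 ∈ D)
    {v : EuclideanSpace ℝ (Fin d)} (hv : ‖v‖ = 1) :
    |inner ℝ v (∫ ω in p.observe ⁻¹' G, ω.1 ∂(sampleLaw μ))| ≤
      (volume : Measure unitInterval).real D * B := by
  have hsample : Integrable (fun ω : Sample d => ω.1) (sampleLaw μ) := hM.integrable_id.comp_fst _
  have habs : Integrable (fun ω : Sample d => |inner ℝ v ω.1|) (sampleLaw μ) :=
    ((hM.integrable_inner v).comp_fst _).abs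
  rw [← integral_inner hsample.integrableOn]
  calc |∫ ω in p.observe ⁻¹' G, (inner ℝ v ω.1 : ℝ) ∂(sampleLaw μ)|
      ≤ ∫ ω in p.observe ⁻¹' G, |(inner ℝ v ω.1 : ℝ)| ∂(sampleLaw μ) :=
        abs_integral_le_integral_abs
    _ ≤ ∫ ω in {ω : Sample d | ω.2.1.1 ∈ D}, |(inner ℝ v ω.1 : ℝ)| ∂(sampleLaw μ) :=
        setIntegral_mono_set habs.integrableOn (ae_of_all _ fun _ => abs_nonneg _)
          (Filter.Eventually.of_forall fun ω hω => hGD (p.observe ω) hω)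
    _ = (volume : Measure unitInterval).real D * ∫ x, |(inner ℝ v x : ℝ)| ∂μ :=
        setIntegral_seed_mem fun x => |(inner ℝ v x : ℝ)|
    _ ≤ (volume : Measure unitInterval).real D * B := by
        gcongr
        exact hM.integral_abs_inner_le hv

theorem exists_extends_explore (hμ : Integrable (fun x => x) μ) (hp : p.toAlg.IsFinitelyBIC μ)
    {τ : NNReal} (h : p.Informed D V τ) {v₁ : EuclideanSpace ℝ (Fin d)} (hv₁ : IsMeanDirection μ v₁)
    {n : ℕ} (hn : 0 < n) {G : Set p.Observation} (hG : MeasurableSet G)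
    (hDG : ∀ q, q.1.1 ∈ D → q ∈ G) {a b : EuclideanSpace ℝ (Fin d)} {κ ζ r : ℝ}
    (ha : ‖a‖ = 1) (hr : 0 ≤ r) (hint : ∫ ω in p.observe ⁻¹' G, ω.1 ∂(sampleLaw μ) = r • a)
    (hb : ‖b‖ = 1) (hbV : b ∈ Vᗮ) (hab : a = κ • v₁ + ζ • b) (hζ : ζ ≠ 0)
    (hτ : (1 + κ ^ 2) / (n * ζ ^ 2) ≤ τ) :
    ∃ p' : Policy d, p'.toAlg.IsFinitelyBIC μ ∧ p.Extends p' ∧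
      p'.horizon = p.horizon + (n + n) ∧ p'.Informed D (V ⊔ ℝ ∙ b) τ := by
  obtain ⟨p₁, hp₁, hext₁, hhor₁, hact₁⟩ := exists_extends_block hμ hp n hG ha hr hint
  obtain ⟨p₂, hp₂, hext₂, hhor₂, hact₂⟩ :=
    exists_extends_const hμ hp₁ n hv₁.norm_eq_one (norm_nonneg _) hv₁.integral_eq
  have hhor : p₂.horizon = p.horizon + (n + n) := by rw [hhor₂, hhor₁, add_assoc]
  refine ⟨p₂, hp₂, hext₁.trans hext₂, hhor, h.sup_span_singleton (hext₁.trans hext₂) hn hhor hb hbV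
    hab hζ hτ (fun i hi ω hω => ?_) fun i _ ω _ => ?_⟩
  · rw [hext₂.action_eq _ (by lia)]
    exact hact₁ _ (Nat.le_add_right _ _) ω (hDG _ hω)
  · exact hact₂ _ (by lia) ω

end Policy

namespace Policy

variable {d : ℕ} {μ : Measure (EuclideanSpace ℝ (Fin d))} [IsProbabilityMeasure μ] {p : Policy d}
  {V : Submodule ℝ (EuclideanSpace ℝ (Fin d))} {B : ℝ} {v₁ : EuclideanSpace ℝ (Fin d)} {n : ℕ}

section Thinning

variable {c ε q γ : ℝ} {τ : NNReal}

theorem Informed.exists_event_orthogonal_mean (h : p.Informed (lowSeeds γ) V τ)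
    (hM : FourthMomentBound μ B) (hc : 0 < c) (hε : 0 < ε)
    (hhalf : ∀ v : EuclideanSpace ℝ (Fin d), ‖v‖ = 1 → ε ≤ μ.real {x | c ≤ inner ℝ v x})
    (hτ : 2 * Real.exp (-c ^ 2 / (8 * τ)) ≤ c ^ 2 * ε ^ 2 / (16 * B))
    (hq : 0 < q) (hq2 : q ≤ 1 / 2) (hqB : 8 * (q * B) ≤ c * ε) (hγ : γ ∈ Set.Ioc (0 : ℝ) 1) :
    ∃ G : Set p.Observation, MeasurableSet G ∧ (∀ o, o.1.1 ∈ lowSeeds (q * γ) → o ∈ G) ∧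
      ∫ ω in p.observe ⁻¹' G, ω.1 ∂(sampleLaw μ) ∈ Vᗮ := by
  obtain ⟨hγ0, hγ1⟩ := hγ
  have hqγ : 0 ≤ q * γ := by positivity
  have hqγle : q * γ ≤ γ / 2 := by nlinarith
  have hsteers : p.Steers μ (lowSeeds γ \ lowSeeds (q * γ)) V (-((q * γ) • ∫ x, x ∂μ)) := by
    refine (h.mono_set Set.sdiff_subset).steers_of_halfspace
      ((measurableSet_lowSeeds _).diff (measurableSet_lowSeeds _)) hM hc hε hhalf hτ ?_
    rw [volume_real_lowSeeds_diff hqγ (by linarith) hγ1, norm_neg, norm_smul,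
      Real.norm_of_nonneg hqγ]
    calc q * γ * ‖∫ x, x ∂μ‖ ≤ q * γ * B := by gcongr; exact hM.norm_mean_le
      _ = γ * (q * B) := by ring
      _ < γ / 2 * (c * ε / 2) := by nlinarith [mul_pos hγ0 (mul_pos hc hε)]
      _ ≤ (γ - q * γ) * (c * ε / 2) := by gcongr; linarith
  obtain ⟨G, hG, hDG, -, hint⟩ := hsteers.exists_superset hM.integrable_id
    (measurableSet_lowSeeds (q * γ)) disjoint_sdiff_self_left
  refine ⟨G, hG, hDG, (Submodule.starProjection_apply_eq_zero_iff V).1 ?_⟩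
  rw [hint, volume_real_lowSeeds ⟨hqγ, by linarith⟩, neg_add_cancel, map_zero]

theorem Informed.exists_extends_thin (h : p.Informed (lowSeeds γ) V τ) (hM : FourthMomentBound μ B)
    (hp : p.toAlg.IsFinitelyBIC μ) (hv₁ : IsMeanDirection μ v₁) (hn : 0 < n)
    (hτn : (n : ℝ)⁻¹ ≤ τ) (hc : 0 < c) (hε : 0 < ε)
    (hhalf : ∀ v : EuclideanSpace ℝ (Fin d), ‖v‖ = 1 → ε ≤ μ.real {x | c ≤ inner ℝ v x})
    (hτ : 2 * Real.exp (-c ^ 2 / (8 * τ)) ≤ c ^ 2 * ε ^ 2 / (16 * B))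
    (hq : 0 < q) (hq2 : q ≤ 1 / 2) (hqB : 8 * (q * B) ≤ c * ε) (hγ : γ ∈ Set.Ioc (0 : ℝ) 1)
    (hV : V ≠ ⊤) :
    ∃ (b : EuclideanSpace ℝ (Fin d)) (p' : Policy d), b ∈ Vᗮ ∧ b ≠ 0 ∧
      p'.toAlg.IsFinitelyBIC μ ∧ p.Extends p' ∧ p'.horizon = p.horizon + (n + n) ∧
      p'.Informed (lowSeeds (q * γ)) (V ⊔ ℝ ∙ b) τ := by
  obtain ⟨G, hG, hDG, hint⟩ :=
    h.exists_event_orthogonal_mean hM hc hε hhalf hτ hq hq2 hqB hγ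
  obtain ⟨b, hbV, hb, heq⟩ : ∃ b ∈ Vᗮ, ‖b‖ = 1 ∧
      ∫ ω in p.observe ⁻¹' G, ω.1 ∂(sampleLaw μ) =
        ‖∫ ω in p.observe ⁻¹' G, ω.1 ∂(sampleLaw μ)‖ • b := by
    obtain ⟨e, heV, he⟩ := exists_norm_eq_one_mem_orthogonal hV
    obtain ⟨b, hb, heq⟩ := exists_norm_eq_one_eq_smul (E := Vᗮ) (x := ⟨_, hint⟩) (e := ⟨e, heV⟩) he
    exact ⟨b, b.2, hb, congrArg Subtype.val heq⟩
  have hqγ : q * γ ≤ γ := mul_le_of_le_one_left hγ.1.le (by linarith)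
  obtain ⟨p', hp', hext, hhor, hinf⟩ := exists_extends_explore (a := b) (κ := 0) (ζ := 1)
    hM.integrable_id hp (h.mono_set (lowSeeds_mono hqγ)) hv₁ hn hG hDG hb (norm_nonneg _) heq hb hbV
    (by simp) one_ne_zero (by simpa using hτn)
  exact ⟨b, p', hbV, ne_zero_of_norm_ne_zero (by simp [hb]), hp', hext, hhor, hinf⟩

theorem exists_initial_exploration (hM : FourthMomentBound μ B) (hv₁ : IsMeanDirection μ v₁)
    (hn : 0 < n) (hτn : (n : ℝ)⁻¹ ≤ τ) (hc : 0 < c) (hε : 0 < ε)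
    (hhalf : ∀ v : EuclideanSpace ℝ (Fin d), ‖v‖ = 1 → ε ≤ μ.real {x | c ≤ inner ℝ v x})
    (hτ : 2 * Real.exp (-c ^ 2 / (8 * τ)) ≤ c ^ 2 * ε ^ 2 / (16 * B))
    (hq : 0 < q) (hq2 : q ≤ 1 / 2) (hqB : 8 * (q * B) ≤ c * ε) :
    ∃ p : Policy d, p.toAlg.IsFinitelyBIC μ ∧ p.horizon = n + (d - 1) * (n + n) ∧
      p.Informed Set.univ (ℝ ∙ v₁) τ ∧ p.Informed (lowSeeds (q ^ (d - 1))) ⊤ τ := by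
  let p₀ : Policy d := ⟨0, fun _ _ _ => 0, by simp, fun _ => measurable_const⟩
  obtain ⟨p₁, hp₁, -, hhor₁, hact₁⟩ := exists_extends_const hM.integrable_id
    (p := p₀) (fun t ht => absurd ht t.not_lt_zero) n hv₁.norm_eq_one (norm_nonneg _)
    hv₁.integral_eq
  replace hhor₁ : p₁.horizon = n := hhor₁.trans (Nat.zero_add n)
  have hline : p₁.Informed Set.univ (ℝ ∙ v₁) τ := Informed.span_singleton hv₁.norm_eq_one
    (hhor₁ ▸ hn) (hhor₁ ▸ hτn) fun t _ => hact₁ t t.zero_le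
  have hloop := induction_finrank_of_orthogonal_step
    (motive := fun k V => ∃ p : Policy d, p.toAlg.IsFinitelyBIC μ ∧
      p.horizon = n + k * (n + n) ∧ p.Informed Set.univ (ℝ ∙ v₁) τ ∧
      p.Informed (lowSeeds (q ^ k)) V τ)
    (ne_zero_of_norm_ne_zero (by simp [hv₁.norm_eq_one]))
    ⟨p₁, hp₁, by simpa using hhor₁, hline, hline.mono_set (Set.subset_univ _)⟩ ?_
  · rwa [finrank_euclideanSpace_fin] at hloop
  · rintro k V - hV ⟨p, hp, hhor, hmean, hinf⟩
    obtain ⟨b, p', hbV, hb, hp', hext, hhor', hinf'⟩ := hinf.exists_extends_thin hM hp hv₁ hn hτn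
      hc hε hhalf hτ hq hq2 hqB ⟨pow_pos hq k, pow_le_one₀ hq.le (by linarith)⟩ hV
    exact ⟨b, hbV, hb, p', hp', by rw [hhor', hhor]; ring, hmean.of_extends hext,
      (pow_succ' q k).symm ▸ hinf'⟩

end Thinning

section Doubling

variable {σ α α' : ℝ} {r : NNReal} {b : EuclideanSpace ℝ (Fin d)}

theorem Informed.exists_event_integral_eq (h : p.Informed (lowSeeds α) (ℝ ∙ v₁)ᗮ (r ^ 2))
    (hM : FourthMomentBound μ B) (hv₁ : IsMeanDirection μ v₁) (hσ : 0 < σ)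
    (hvar : ∀ v : EuclideanSpace ℝ (Fin d), ‖v‖ = 1 → σ ≤ variance (fun x => inner ℝ v x) μ)
    (hr : 0 < r) (hrσ : 32 * B * r ≤ σ * √σ) (hα : 0 < α) (hαα' : α ≤ α') (hα'2 : α' ≤ 2 * α)
    (hα' : α' ≤ 1) (hb : ‖b‖ = 1) (hbv₁ : b ∈ (ℝ ∙ v₁)ᗮ) :
    ∃ G : Set p.Observation, MeasurableSet G ∧
      (∀ o, o.1.1 ∈ lowSeeds α' \ lowSeeds α → o ∈ G) ∧
      ∃ β : ℝ, |β| ≤ 2 * α * B ∧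
        ∫ ω in p.observe ⁻¹' G, ω.1 ∂(sampleLaw μ) = β • v₁ + (α * r) • b := by
  have hB := hM.pos
  have hr' : (0 : ℝ) < r := hr
  have hmean : ∫ x, x ∂μ ∈ (ℝ ∙ v₁)ᗮᗮ := by
    rw [Submodule.orthogonal_orthogonal, hv₁.integral_eq]
    exact Submodule.smul_mem _ _ (Submodule.mem_span_singleton_self v₁)
  have hsteers : p.Steers μ (lowSeeds α) (ℝ ∙ v₁)ᗮ ((α * r) • b) := by
    refine h.steers_of_variance (measurableSet_lowSeeds α) hM hσ hvar hmean ?_ ?_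
    · rw [NNReal.coe_pow, Real.sqrt_sq hr'.le, le_div_iff₀ (by positivity)]
      linarith
    · rw [volume_real_lowSeeds ⟨hα.le, hαα'.trans hα'⟩, norm_smul, hb, mul_one,
        Real.norm_of_nonneg (by positivity)]
      refine mul_lt_mul_of_pos_left ((lt_div_iff₀ (by positivity)).2 ?_) hα
      nlinarith [mul_pos hB hr']
  obtain ⟨G, hG, hDG, hGD, hproj⟩ := hsteers.exists_superset hM.integrable_id
    ((measurableSet_lowSeeds α').diff (measurableSet_lowSeeds α)) disjoint_sdiff_self_right
  refine ⟨G, hG, hDG, _, ?_, eq_inner_smul_add_of_starProjection_orthogonal_eq hv₁.norm_eq_one ?_⟩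
  · rw [Set.union_sdiff_cancel (lowSeeds_mono hαα')] at hGD
    refine (abs_inner_setIntegral_observe_le hM hGD hv₁.norm_eq_one).trans ?_
    rw [volume_real_lowSeeds ⟨hα.le.trans hαα', hα'⟩]
    gcongr
  · rw [hproj, map_add, map_smul _ _ (∫ x, x ∂μ),
      (Submodule.starProjection_apply_eq_zero_iff _).2 hmean, smul_zero, add_zero]
    exact Submodule.starProjection_eq_self_iff.2 (Submodule.smul_mem _ _ hbv₁)

theorem exists_extends_explore_of_integral_eq (hμ : Integrable (fun x => x) μ)
    (hp : p.toAlg.IsFinitelyBIC μ) {D : Set unitInterval} {τ : NNReal} (h : p.Informed D V τ)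
    (hv₁ : IsMeanDirection μ v₁) (hv₁V : v₁ ∈ V) (hn : 0 < n) {G : Set p.Observation}
    (hG : MeasurableSet G) (hDG : ∀ o, o.1.1 ∈ D → o ∈ G) (hb : ‖b‖ = 1) (hbV : b ∈ Vᗮ)
    {β ξ : ℝ} (hξ : 0 < ξ)
    (hint : ∫ ω in p.observe ⁻¹' G, ω.1 ∂(sampleLaw μ) = β • v₁ + ξ • b)
    (hτ : (2 * β ^ 2 + ξ ^ 2) / (n * ξ ^ 2) ≤ τ) :
    ∃ p' : Policy d, p'.toAlg.IsFinitelyBIC μ ∧ p.Extends p' ∧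
      p'.horizon = p.horizon + (n + n) ∧ p'.Informed D (V ⊔ ℝ ∙ b) τ := by
  set m := β • v₁ + ξ • b with hm
  have hnorm : ‖m‖ ^ 2 = β ^ 2 + ξ ^ 2 := by
    rw [hm, norm_add_sq_real, real_inner_smul_left, real_inner_smul_right,
      Submodule.inner_right_of_mem_orthogonal hv₁V hbV, norm_smul, norm_smul, hb,
      hv₁.norm_eq_one]
    simp
  have hm0 : 0 < ‖m‖ := (norm_nonneg m).lt_of_ne' fun h0 => by
    rw [h0] at hnorm
    nlinarith [pow_pos hξ 2]
  refine exists_extends_explore (a := ‖m‖⁻¹ • m) (κ := ‖m‖⁻¹ * β) (ζ := ‖m‖⁻¹ * ξ) hμ hp h hv₁ hn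
    hG hDG (norm_smul_inv_norm (norm_pos_iff.1 hm0)) hm0.le
    (hint.trans (smul_inv_smul₀ hm0.ne' m).symm) hb hbV ?_ (by positivity) (hτ.trans' (le_of_eq ?_))
  · rw [mul_smul, mul_smul, ← smul_add]
  · have hn' : (n : ℝ) ≠ 0 := by exact_mod_cast hn.ne'
    field_simp
    rw [hnorm]
    ring

theorem Informed.exists_extends_double (hall : p.Informed (lowSeeds α) ⊤ (r ^ 2))
    (h : p.Informed (lowSeeds α' \ lowSeeds α) V (r ^ 2)) (hM : FourthMomentBound μ B)
    (hp : p.toAlg.IsFinitelyBIC μ) (hv₁ : IsMeanDirection μ v₁) (hσ : 0 < σ)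
    (hvar : ∀ v : EuclideanSpace ℝ (Fin d), ‖v‖ = 1 → σ ≤ variance (fun x => inner ℝ v x) μ)
    (hr : 0 < r) (hrσ : 32 * B * r ≤ σ * √σ) (hrB : r ≤ B) (hn : 9 * B ^ 2 ≤ n * r ^ 4)
    (hα : 0 < α) (hαα' : α ≤ α') (hα'2 : α' ≤ 2 * α) (hα' : α' ≤ 1) (hv₁V : v₁ ∈ V) (hV : V ≠ ⊤) :
    ∃ (b : EuclideanSpace ℝ (Fin d)) (p' : Policy d), b ∈ Vᗮ ∧ b ≠ 0 ∧
      p'.toAlg.IsFinitelyBIC μ ∧ p.Extends p' ∧ p'.horizon = p.horizon + (n + n) ∧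
      p'.Informed (lowSeeds α' \ lowSeeds α) (V ⊔ ℝ ∙ b) (r ^ 2) := by
  have hr' : (0 : ℝ) < r := hr
  have hn0 : 0 < n := Nat.pos_of_ne_zero fun h0 => by
    rw [h0, Nat.cast_zero, zero_mul] at hn
    linarith [pow_pos hM.pos 2]
  obtain ⟨b, hbV, hb⟩ := exists_norm_eq_one_mem_orthogonal hV
  have hbv₁ : b ∈ (ℝ ∙ v₁)ᗮ :=
    Submodule.orthogonal_le ((Submodule.span_singleton_le_iff_mem v₁ V).2 hv₁V) hbV
  obtain ⟨G, hG, hDG, β, hβ, hint⟩ := (hall.mono_space le_top).exists_event_integral_eq hM hv₁ hσ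
    hvar hr hrσ hα hαα' hα'2 hα' hb hbv₁
  have hτ : (2 * β ^ 2 + (α * r) ^ 2) / (n * (α * r) ^ 2) ≤ r ^ 2 := by
    have hβ2 : β ^ 2 ≤ (2 * α * B) ^ 2 := sq_le_sq.2 (hβ.trans (le_abs_self _))
    rw [div_le_iff₀ (by positivity)]
    calc 2 * β ^ 2 + (α * r) ^ 2 ≤ 2 * (2 * α * B) ^ 2 + (α * B) ^ 2 := by gcongr
      _ = α ^ 2 * (9 * B ^ 2) := by ring
      _ ≤ α ^ 2 * (n * r ^ 4) := by gcongr
      _ = r ^ 2 * (n * (α * r) ^ 2) := by ring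
  obtain ⟨p', hp', hext, hhor, hinf⟩ := exists_extends_explore_of_integral_eq hM.integrable_id hp h
    hv₁ hv₁V hn0 hG hDG hb hbV (mul_pos hα hr') hint (by simpa only [NNReal.coe_pow] using hτ)
  exact ⟨b, p', hbV, ne_zero_of_norm_ne_zero (by simp [hb]), hp', hext, hhor, hinf⟩

theorem exists_extends_doubling_seeds (hM : FourthMomentBound μ B)
    (hp : p.toAlg.IsFinitelyBIC μ) (hv₁ : IsMeanDirection μ v₁) (hσ : 0 < σ)
    (hvar : ∀ v : EuclideanSpace ℝ (Fin d), ‖v‖ = 1 → σ ≤ variance (fun x => inner ℝ v x) μ)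
    (hr : 0 < r) (hrσ : 32 * B * r ≤ σ * √σ) (hrB : r ≤ B) (hn : 9 * B ^ 2 ≤ n * r ^ 4)
    (hα : 0 < α) (hαα' : α ≤ α') (hα'2 : α' ≤ 2 * α) (hα' : α' ≤ 1)
    (hline : p.Informed Set.univ (ℝ ∙ v₁) (r ^ 2)) (h : p.Informed (lowSeeds α) ⊤ (r ^ 2)) :
    ∃ p' : Policy d, p'.toAlg.IsFinitelyBIC μ ∧ p.Extends p' ∧
      p'.horizon = p.horizon + (d - 1) * (n + n) ∧ p'.Informed (lowSeeds α') ⊤ (r ^ 2) := by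
  have hloop := induction_finrank_of_orthogonal_step
    (motive := fun k V => ∃ p' : Policy d, p'.toAlg.IsFinitelyBIC μ ∧ p.Extends p' ∧
      p'.horizon = p.horizon + k * (n + n) ∧ p'.Informed (lowSeeds α' \ lowSeeds α) V (r ^ 2))
    (ne_zero_of_norm_ne_zero (by simp [hv₁.norm_eq_one]))
    ⟨p, hp, .refl p, by simp, hline.mono_set (Set.subset_univ _)⟩ ?_
  · rw [finrank_euclideanSpace_fin] at hloop
    obtain ⟨p', hp', hext, hhor, hinf⟩ := hloop
    refine ⟨p', hp', hext, hhor, ?_⟩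
    rw [← Set.union_sdiff_cancel (lowSeeds_mono hαα')]
    exact (h.of_extends hext).union hinf (measurableSet_lowSeeds α)
  · rintro k V hv₁V hV ⟨p', hp', hext, hhor, hinf⟩
    obtain ⟨b, p'', hbV, hb, hp'', hext', hhor', hinf'⟩ := (h.of_extends hext).exists_extends_double
      hinf hM hp' hv₁ hσ hvar hr hrσ hrB hn hα hαα' hα'2 hα' hv₁V hV
    exact ⟨b, hbV, hb, p'', hp'', hext.trans hext', by rw [hhor', hhor]; ring, hinf'⟩

theorem exists_extends_all_seeds (hM : FourthMomentBound μ B)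
    (hp : p.toAlg.IsFinitelyBIC μ) (hv₁ : IsMeanDirection μ v₁) (hσ : 0 < σ)
    (hvar : ∀ v : EuclideanSpace ℝ (Fin d), ‖v‖ = 1 → σ ≤ variance (fun x => inner ℝ v x) μ)
    (hr : 0 < r) (hrσ : 32 * B * r ≤ σ * √σ) (hrB : r ≤ B) (hn : 9 * B ^ 2 ≤ n * r ^ 4)
    (hα : α ∈ Set.Ioc (0 : ℝ) 1) {J : ℕ} (hJ : 1 ≤ 2 ^ J * α)
    (hline : p.Informed Set.univ (ℝ ∙ v₁) (r ^ 2)) (h : p.Informed (lowSeeds α) ⊤ (r ^ 2)) :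
    ∃ p' : Policy d, p'.toAlg.IsFinitelyBIC μ ∧
      p'.horizon = p.horizon + J * ((d - 1) * (n + n)) ∧ p'.Informed Set.univ ⊤ (r ^ 2) := by
  obtain ⟨hα0, hα1⟩ := hα
  suffices hloop : ∀ j : ℕ, ∃ p' : Policy d, p'.toAlg.IsFinitelyBIC μ ∧ p.Extends p' ∧
      p'.horizon = p.horizon + j * ((d - 1) * (n + n)) ∧
      p'.Informed (lowSeeds (min 1 (2 ^ j * α))) ⊤ (r ^ 2) by
    obtain ⟨p', hp', -, hhor, hinf⟩ := hloop J
    rw [min_eq_left hJ, lowSeeds_one] at hinf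
    exact ⟨p', hp', hhor, hinf⟩
  intro j
  induction j with
  | zero => exact ⟨p, hp, .refl p, by simp, by simpa [min_eq_right hα1] using h⟩
  | succ j ih =>
    obtain ⟨p', hp', hext, hhor, hinf⟩ := ih
    have hpow : (0 : ℝ) < 2 ^ j * α := by positivity
    have hsucc : (2 : ℝ) ^ (j + 1) * α = 2 * (2 ^ j * α) := by ring
    obtain ⟨p'', hp'', hext', hhor', hinf'⟩ := exists_extends_doubling_seeds
      (α' := min 1 (2 ^ (j + 1) * α)) hM hp' hv₁ hσ hvar hr hrσ hrB hn (lt_min one_pos hpow)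
      (min_le_min_left _ (by linarith))
      (by rw [hsucc, mul_min_of_nonneg _ _ zero_le_two]; exact min_le_min_right _ (by norm_num))
      (min_le_left _ _) (hline.of_extends hext) hinf
    exact ⟨p'', hp'', hext.trans hext', by rw [hhor', hhor]; ring, hinf'⟩

end Doubling

end Policy

/-! ### Parameters and round counts -/

namespace PriorAssumption

variable {d : ℕ} {μ : Measure (EuclideanSpace ℝ (Fin d))} [IsProbabilityMeasure μ] {c ε σ K B : ℝ}
  {v : EuclideanSpace ℝ (Fin d)}

theorem ε_le_half (h : PriorAssumption μ c ε σ K) (hv : ‖v‖ = 1) : ε ≤ 1 / 2 := by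
  have hdisj : Disjoint {x : EuclideanSpace ℝ (Fin d) | c ≤ inner ℝ v x}
      {x | c ≤ inner ℝ (-v) x} := Set.disjoint_left.2 fun x hx hx' => by
    rw [Set.mem_ofPred_eq, inner_neg_left] at hx'
    linarith [h.c_pos, Set.mem_ofPred_eq ▸ hx]
  have hunion := measureReal_union (μ := μ) hdisj (measurableSet_le measurable_const (by fun_prop))
  linarith [h.halfspace v hv, h.halfspace (-v) (by rwa [norm_neg]),
    measureReal_le_one (μ := μ) (s := {x | c ≤ inner ℝ v x} ∪ {x | c ≤ inner ℝ (-v) x})]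

theorem σ_le (h : PriorAssumption μ c ε σ K) (hM : FourthMomentBound μ B) (hv : ‖v‖ = 1) :
    σ ≤ B :=
  (h.covariance v hv).trans <| (variance_le_expectation_sq (by fun_prop)).trans (hM.two_le hv)

theorem c_mul_ε_le (h : PriorAssumption μ c ε σ K) (hM : FourthMomentBound μ B) (hv : ‖v‖ = 1) :
    c * ε ≤ B := by
  have hc := h.c_pos
  calc c * ε ≤ c * μ.real {x | c ≤ |(inner ℝ v x : ℝ)|} := by
        gcongr
        exact (h.halfspace v hv).trans (measureReal_mono fun x hx =>
          (show c ≤ inner ℝ v x from hx).trans (le_abs_self _))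
    _ ≤ ∫ x, |(inner ℝ v x : ℝ)| ∂μ := mul_meas_ge_le_integral_of_nonneg
        (ae_of_all _ fun x => abs_nonneg _) (hM.integrable_inner v).abs c
    _ ≤ B := hM.integral_abs_inner_le hv

theorem log_one_div_mul_le (h : PriorAssumption μ c ε σ K) (hM : FourthMomentBound μ B)
    (hv : ‖v‖ = 1) :
    Real.log (1 / (c * ε)) ≤ B * max 1 (Real.log (1 / (σ * ε * c))) := by
  have hc := h.c_pos
  have hε := h.ε_pos
  have hσ := h.σ_pos
  have hsplit : Real.log (1 / (c * ε)) = Real.log (1 / (σ * ε * c)) + Real.log σ := by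
    rw [← Real.log_mul (by positivity) hσ.ne']
    congr 1
    field_simp
  have hlogσ : Real.log σ ≤ B - 1 :=
    (Real.log_le_sub_one_of_pos hσ).trans (sub_le_sub_right (h.σ_le hM hv) 1)
  rw [hsplit]
  nlinarith [hM.one_le, le_max_left 1 (Real.log (1 / (σ * ε * c))),
    le_max_right 1 (Real.log (1 / (σ * ε * c)))]

theorem exists_policy_horizon_eq (h : PriorAssumption μ c ε σ K) (hM : FourthMomentBound μ B)
    (hd : 0 < d) {q : ℝ} (hq : 0 < q) (hq2 : q ≤ 1 / 2) (hqB : 8 * (q * B) ≤ c * ε) {r : NNReal}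
    (hr : 0 < r) (hrσ : 32 * B * r ≤ σ * √σ) (hrB : r ≤ B) {n₁ n₂ j : ℕ} (hn₁ : 0 < n₁)
    (hexp : 2 * Real.exp (-(c ^ 2 * n₁ / 8)) ≤ c ^ 2 * ε ^ 2 / (16 * B))
    (hn₁r : (n₁ : ℝ)⁻¹ ≤ r ^ 2) (hn₂ : 9 * B ^ 2 ≤ n₂ * r ^ 4) (hj : 1 ≤ 2 ^ j * q) :
    ∃ p : Policy d, p.toAlg.IsFinitelyBIC μ ∧
      p.horizon = n₁ + (d - 1) * (n₁ + n₁) + j * (d - 1) * ((d - 1) * (n₂ + n₂)) ∧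
      p.Informed Set.univ ⊤ (r ^ 2) := by
  obtain ⟨v₁, hv₁⟩ := exists_isMeanDirection hd μ
  have hn₁r' : (n₁ : NNReal)⁻¹ ≤ r ^ 2 := by exact_mod_cast hn₁r
  obtain ⟨p₁, hp₁, hhor₁, hline, hinf₁⟩ := Policy.exists_initial_exploration
    (τ := (n₁ : NNReal)⁻¹) hM hv₁ hn₁ (by simp) h.c_pos h.ε_pos h.halfspace
    (by convert hexp using 3; push_cast; field_simp) hq hq2 hqB
  have hJ : 1 ≤ 2 ^ (j * (d - 1)) * q ^ (d - 1) := by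
    rw [pow_mul, ← mul_pow]
    exact one_le_pow₀ hj
  obtain ⟨p₂, hp₂, hhor₂, hinf₂⟩ := Policy.exists_extends_all_seeds hM hp₁ hv₁ h.σ_pos
    h.covariance hr hrσ hrB hn₂ ⟨pow_pos hq _, pow_le_one₀ hq.le (by linarith)⟩ hJ
    (hline.mono_covariance hn₁r') (hinf₁.mono_covariance hn₁r')
  exact ⟨p₂, hp₂, by rw [hhor₂, hhor₁], hinf₂⟩

end PriorAssumption

theorem one_le_two_pow_mul {q : ℝ} {j : ℕ} (hq : 0 < q) (h : 2 * Real.log (1 / q) ≤ j) :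
    1 ≤ 2 ^ j * q := by
  rw [← div_le_iff₀ hq, ← Real.log_le_log_iff (by positivity) (by positivity), Real.log_pow]
  nlinarith [Real.log_two_gt_d9, j.cast_nonneg (α := ℝ)]

theorem two_mul_exp_neg_le {x y : ℝ} (hx : 0 < x) (h : Real.log (2 / x) ≤ y) :
    2 * Real.exp (-y) ≤ x := by
  rw [Real.exp_neg, ← div_eq_mul_inv, div_le_comm₀ (Real.exp_pos y) hx]
  exact (Real.log_le_iff_le_exp (by positivity)).1 h

theorem total_rounds_le {d : ℕ} {A m ρ : ℝ} (hd : 0 < d) (hA : 0 ≤ A) (hm : 1 ≤ m) (hρ : 1 ≤ ρ) :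
    ((⌈A + ρ⌉₊ + (d - 1) * (⌈A + ρ⌉₊ + ⌈A + ρ⌉₊) +
      ⌈18 * m⌉₊ * (d - 1) * ((d - 1) * (⌈9 * ρ⌉₊ + ⌈9 * ρ⌉₊)) : ℕ) : ℝ) ≤
      2 * d * A + 384 * (m * ((d : ℝ) ^ 2 * ρ)) := by
  have hd1 : (1 : ℝ) ≤ d := by exact_mod_cast hd
  have hn₁ := (Nat.ceil_lt_add_one (by positivity : 0 ≤ A + ρ)).le
  have hn₂ := (Nat.ceil_lt_add_one (by positivity : 0 ≤ 9 * ρ)).le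
  have hj := (Nat.ceil_lt_add_one (by positivity : 0 ≤ 18 * m)).le
  push_cast [Nat.cast_sub (Nat.one_le_iff_ne_zero.2 hd.ne')]
  set n₁ : ℝ := (⌈A + ρ⌉₊ : ℝ)
  set n₂ : ℝ := (⌈9 * ρ⌉₊ : ℝ)
  set j : ℝ := (⌈18 * m⌉₊ : ℝ)
  have hfirst : n₁ + (d - 1) * (n₁ + n₁) ≤ 2 * d * (A + 2 * ρ) :=
    calc n₁ + (d - 1) * (n₁ + n₁) ≤ 2 * d * n₁ := by
          linarith [(Nat.cast_nonneg ⌈A + ρ⌉₊ : 0 ≤ n₁)]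
      _ ≤ 2 * d * (A + 2 * ρ) := by gcongr; linarith
  have hsecond : j * (d - 1) * ((d - 1) * (n₂ + n₂)) ≤ 380 * (m * (d ^ 2 * ρ)) :=
    calc j * (d - 1) * ((d - 1) * (n₂ + n₂)) = 2 * ((d - 1) ^ 2 * (j * n₂)) := by ring
      _ ≤ 2 * (d ^ 2 * (19 * m * (10 * ρ))) := by gcongr <;> linarith
      _ = 380 * (m * (d ^ 2 * ρ)) := by ring
  have hlow : d * ρ ≤ m * (d ^ 2 * ρ) :=
    calc d * ρ ≤ d ^ 2 * ρ := by gcongr; exact le_self_pow₀ hd1 two_ne_zero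
      _ ≤ m * (d ^ 2 * ρ) := le_mul_of_one_le_left (by positivity) hm
  linarith

namespace PriorAssumption

variable {d : ℕ} {μ : Measure (EuclideanSpace ℝ (Fin d))} [IsProbabilityMeasure μ] {c ε σ K B : ℝ}
  {v : EuclideanSpace ℝ (Fin d)}

theorem two_mul_log_one_div_le (h : PriorAssumption μ c ε σ K) (hM : FourthMomentBound μ B)
    (hv : ‖v‖ = 1) :
    2 * Real.log (1 / (c * ε / (8 * B))) ≤ 18 * (B * max 1 (Real.log (1 / (σ * ε * c)))) := by
  have hcε : 0 < c * ε := mul_pos h.c_pos h.ε_pos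
  have hB := hM.one_le
  have hlogB : Real.log (8 * B) ≤ 8 * B :=
    (Real.log_le_sub_one_of_pos (by linarith)).trans (by simp)
  have hL : B ≤ B * max 1 (Real.log (1 / (σ * ε * c))) :=
    le_mul_of_one_le_right (by linarith) (le_max_left _ _)
  rw [show 1 / (c * ε / (8 * B)) = 8 * B * (1 / (c * ε)) by field_simp,
    Real.log_mul (by linarith) (by positivity)]
  linarith [h.log_one_div_mul_le hM hv]

theorem two_mul_exp_neg_sq_mul_le (h : PriorAssumption μ c ε σ K) (hM : FourthMomentBound μ B)
    (hv : ‖v‖ = 1) {n : ℝ} (hn : 272 * (B * max 1 (Real.log (1 / (σ * ε * c)))) ≤ c ^ 2 * n) :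
    2 * Real.exp (-(c ^ 2 * n / 8)) ≤ c ^ 2 * ε ^ 2 / (16 * B) := by
  have hc := h.c_pos
  have hε := h.ε_pos
  have hB : 0 < B := hM.pos
  have hlogB : Real.log (32 * B) ≤ 32 * B :=
    (Real.log_le_sub_one_of_pos (by linarith)).trans (by simp)
  have hL : B ≤ B * max 1 (Real.log (1 / (σ * ε * c))) :=
    le_mul_of_one_le_right hB.le (le_max_left _ _)
  refine two_mul_exp_neg_le (by positivity) ?_
  rw [show 2 / (c ^ 2 * ε ^ 2 / (16 * B)) = 32 * B * (1 / (c * ε)) ^ 2 by field_simp; norm_num,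
    Real.log_mul (by positivity) (by positivity), Real.log_pow]
  push_cast
  linarith [h.log_one_div_mul_le hM hv]

theorem exists_policy_horizon_le (h : PriorAssumption μ c ε σ K) (hM : FourthMomentBound μ B)
    (hd : 0 < d) (hv : ‖v‖ = 1) {r : NNReal} (hr : 0 < r) (hrσ : 32 * B * r ≤ σ * √σ)
    (hr1 : r ≤ 1) {m : ℝ} (hm : B * max 1 (Real.log (1 / (σ * ε * c))) ≤ m) :
    ∃ p : Policy d, p.toAlg.IsFinitelyBIC μ ∧ p.Informed Set.univ ⊤ (r ^ 2) ∧
      (p.horizon : ℝ) ≤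
        2 * d * (272 * m / c ^ 2) + 384 * (m * ((d : ℝ) ^ 2 * (B ^ 2 / r ^ 4))) := by
  have hc := h.c_pos
  have hε := h.ε_pos
  have hB1 := hM.one_le
  have hB : 0 < B := hM.pos
  have hr1' : (r : ℝ) ≤ 1 := hr1
  have hm1 : 1 ≤ m := (one_le_mul_of_one_le_of_one_le hB1 (le_max_left _ _)).trans hm
  have hq : c * ε / (8 * B) ≤ 1 / 2 := by
    rw [div_le_iff₀ (mul_pos (by norm_num) hB)]
    linarith [h.c_mul_ε_le hM hv]
  have hρ : 1 / (r : ℝ) ^ 2 ≤ B ^ 2 / r ^ 4 := by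
    gcongr ?_ / ?_
    · exact one_le_pow₀ hB1
    · exact pow_le_pow_of_le_one r.coe_nonneg hr1' (by norm_num)
  have hρ1 : 1 ≤ 1 / (r : ℝ) ^ 2 := one_le_one_div (by positivity) (pow_le_one₀ r.coe_nonneg hr1')
  have hA : 0 ≤ 272 * m / c ^ 2 := by positivity
  have hn₁ := Nat.le_ceil (272 * m / c ^ 2 + B ^ 2 / (r : ℝ) ^ 4)
  have hn₂ := Nat.le_ceil (9 * (B ^ 2 / (r : ℝ) ^ 4))
  obtain ⟨p, hp, hhor, hinf⟩ := h.exists_policy_horizon_eq hM hd (q := c * ε / (8 * B))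
    (n₁ := ⌈272 * m / c ^ 2 + B ^ 2 / (r : ℝ) ^ 4⌉₊) (j := ⌈18 * m⌉₊)
    (by positivity) hq (by field_simp; rfl) hr hrσ (by exact_mod_cast hr1'.trans hB1)
    (Nat.ceil_pos.2 (by linarith))
    (h.two_mul_exp_neg_sq_mul_le hM hv <|
      (mul_le_mul_of_nonneg_left hm (by norm_num)).trans <|
        (div_le_iff₀' (by positivity)).1 (by linarith))
    (inv_le_of_inv_le₀ (by positivity) (by rw [← one_div]; linarith))
    ((div_le_iff₀ (by positivity)).1 (by rwa [mul_div_assoc]))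
    (one_le_two_pow_mul (by positivity) <|
      (h.two_mul_log_one_div_le hM hv).trans <|
        (mul_le_mul_of_nonneg_left hm (by norm_num)).trans (Nat.le_ceil _))
  exact ⟨p, hp, hinf, hhor ▸ total_rounds_le hd hA hm1 (hρ1.trans hρ)⟩

theorem exists_policy (h : PriorAssumption μ c ε σ K) (hM : FourthMomentBound μ B) (hd : 0 < d)
    (hv : ‖v‖ = 1) :
    ∃ p : Policy d, p.toAlg.IsFinitelyBIC μ ∧ p.Informed Set.univ ⊤ 1 ∧
      (p.horizon : ℝ) ≤ 10 ^ 9 * B ^ 11 * max 1 (Real.log (1 / (σ * ε * c))) *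
        ((d : ℝ) ^ 2 / σ ^ 6 + d / c ^ 2) := by
  have hσ := h.σ_pos
  have hc := h.c_pos
  have hB1 := hM.one_le
  have hB : 0 < B := hM.pos
  obtain ⟨r, hrdef⟩ : ∃ r : NNReal, (r : ℝ) = σ * √σ / (32 * B ^ 2) :=
    ⟨_, Real.coe_toNNReal _ (by positivity)⟩
  have hr4 : (r : ℝ) ^ 4 = σ ^ 6 / (2 ^ 20 * B ^ 8) := by
    rw [hrdef, div_pow, mul_pow σ, show √σ ^ 4 = (√σ ^ 2) ^ 2 by ring, Real.sq_sqrt hσ.le]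
    field_simp
    norm_num
  have hr1 : (r : ℝ) ≤ 1 := by
    refine (pow_le_one_iff_of_nonneg r.coe_nonneg four_ne_zero).1 ?_
    rw [hr4, div_le_one (by positivity)]
    calc σ ^ 6 ≤ B ^ 6 := by gcongr; exact h.σ_le hM hv
      _ ≤ 2 ^ 20 * B ^ 8 := by
          nlinarith [pow_le_pow_right₀ hB1 (show 6 ≤ 8 by norm_num), pow_pos hB 8]
  obtain ⟨p, hp, hinf, hhor⟩ := h.exists_policy_horizon_le hM hd hv (r := r)
    (by rw [← NNReal.coe_pos, hrdef]; positivity)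
    (by rw [hrdef]; field_simp; exact hB1) hr1 le_rfl
  refine ⟨p, hp, hinf.mono_covariance (pow_le_one₀ zero_le hr1), hhor.trans ?_⟩
  rw [hr4]
  set L := max 1 (Real.log (1 / (σ * ε * c)))
  have hL : 0 < L := lt_max_of_lt_left one_pos
  calc 2 * d * (272 * (B * L) / c ^ 2) +
        384 * (B * L * ((d : ℝ) ^ 2 * (B ^ 2 / (σ ^ 6 / (2 ^ 20 * B ^ 8)))))
      = 544 * B ^ 1 * L * (d / c ^ 2) + 384 * 2 ^ 20 * B ^ 11 * L * (d ^ 2 / σ ^ 6) := by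
        field_simp
        ring
    _ ≤ 10 ^ 9 * B ^ 11 * L * (d / c ^ 2) + 10 ^ 9 * B ^ 11 * L * (d ^ 2 / σ ^ 6) := by
        gcongr <;> norm_num [hB1]
    _ = 10 ^ 9 * B ^ 11 * L * ((d : ℝ) ^ 2 / σ ^ 6 + d / c ^ 2) := by ring

end PriorAssumption

theorem div_add_div_le_of_le_div {d σ c lam : ℝ} (hd : 1 ≤ d) (hσ : 0 < σ) (hc : 0 < c)
    (hlam : 0 < lam) (hlam1 : lam ≤ 1) (hlamσ : lam ≤ σ / d) :
    d ^ 2 / σ ^ 6 + d / c ^ 2 ≤ d ^ 5 / (lam ^ 4 * σ ^ 2) + d ^ 4 / (c ^ 2 * lam ^ 4) := by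
  have hle : lam ≤ σ := hlamσ.trans (div_le_self hσ.le hd)
  rw [show σ ^ 6 = σ ^ 4 * σ ^ 2 by ring]
  gcongr
  · norm_num
  · exact le_self_pow₀ hd (by norm_num)
  · exact mul_le_of_le_one_right (by positivity) (pow_le_one₀ hlam.le hlam1)

theorem one_le_mul_div_min {d σ c B : ℝ} (hd : 1 ≤ d) (hσ : 0 < σ) (hc : 0 < c) (hσB : σ ≤ B) :
    1 ≤ B * (d / min σ c) := by
  rw [mul_div_assoc', le_div_iff₀ (lt_min hσ hc), one_mul]
  exact (min_le_left σ c).trans (hσB.trans (le_mul_of_one_le_right (hσ.le.trans hσB) hd))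

theorem div_add_div_le_div_min_pow {d σ c B : ℝ} (hd : 1 ≤ d) (hσ : 0 < σ) (hc : 0 < c)
    (hB : 1 ≤ B) (hσB : σ ≤ B) :
    d ^ 2 / σ ^ 6 + d / c ^ 2 ≤ 2 * B ^ 4 * (d / min σ c) ^ 6 := by
  have hσ6 : d ^ 2 / σ ^ 6 ≤ (d / min σ c) ^ 6 := by
    rw [div_pow]
    gcongr
    · norm_num
    · exact min_le_left σ c
  have hc2 : d / c ^ 2 ≤ (d / min σ c) ^ 2 := by
    rw [div_pow]
    gcongr
    · exact le_self_pow₀ hd (by norm_num)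
    · exact min_le_right σ c
  have hpow : (d / min σ c) ^ 2 ≤ B ^ 4 * (d / min σ c) ^ 6 := by
    rw [show B ^ 4 * (d / min σ c) ^ 6 = (B * (d / min σ c)) ^ 4 * (d / min σ c) ^ 2 by ring]
    exact le_mul_of_one_le_left (by positivity)
      (one_le_pow₀ (one_le_mul_div_min hd hσ hc hσB))
  have hB4 : (d / min σ c) ^ 6 ≤ B ^ 4 * (d / min σ c) ^ 6 :=
    le_mul_of_one_le_left (by positivity) (one_le_pow₀ hB)
  linarith

theorem neg_log_le_div {d m y : ℝ} (hd : 1 ≤ d) (hm : 0 < m) (hy : m ≤ y) :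
    -Real.log y ≤ d / m := by
  have hy0 : 0 < y := hm.trans_le hy
  calc -Real.log y = Real.log y⁻¹ := (Real.log_inv y).symm
    _ ≤ y⁻¹ := (Real.log_le_sub_one_of_pos (by positivity)).trans (by simp)
    _ ≤ m⁻¹ := by gcongr
    _ ≤ d / m := by rw [div_eq_mul_inv]; exact le_mul_of_one_le_left (by positivity) hd

theorem max_one_log_le {d σ c ε B : ℝ} (hd : 1 ≤ d) (hσ : 0 < σ) (hc : 0 < c) (hε : 0 < ε)
    (hε2 : ε ≤ 1 / 2) (hB : 1 ≤ B) (hσB : σ ≤ B) :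
    max 1 (Real.log (1 / (σ * ε * c))) ≤ 7 * B * (d / min σ c * Real.log (1 / ε)) := by
  have hmin : 0 < min σ c := lt_min hσ hc
  set x := d / min σ c
  set ℓ := Real.log (1 / ε)
  have hx : 0 < x := by positivity
  have hℓ : 1 / 2 ≤ ℓ := by
    have hlog2 : Real.log 2 ≤ ℓ :=
      Real.log_le_log two_pos (by rw [le_div_iff₀ hε]; linarith)
    linarith [Real.log_two_gt_d9]
  have hsplit : Real.log (1 / (σ * ε * c)) = ℓ - Real.log σ - Real.log c := by
    simp only [ℓ, one_div, Real.log_inv]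
    rw [Real.log_mul (by positivity) hc.ne', Real.log_mul hσ.ne' hε.ne']
    ring
  have hmax : max 1 (Real.log (1 / (σ * ε * c))) ≤ 1 + ℓ + 2 * x := by
    refine max_le (by linarith) ?_
    linarith [neg_log_le_div hd hmin (min_le_left σ c), neg_log_le_div hd hmin (min_le_right σ c)]
  have hℓx : ℓ ≤ B * x * ℓ :=
    le_mul_of_one_le_left (by linarith) (one_le_mul_div_min hd hσ hc hσB)
  have hxℓ : x ≤ 2 * (x * ℓ) := by nlinarith
  have hBxℓ : x * ℓ ≤ B * (x * ℓ) := le_mul_of_one_le_left (by positivity) hB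
  linarith

theorem rounds_le_div_min_pow {d σ c ε B : ℝ} (hd : 1 ≤ d) (hσ : 0 < σ) (hc : 0 < c) (hε : 0 < ε)
    (hε2 : ε ≤ 1 / 2) (hB : 1 ≤ B) (hσB : σ ≤ B) :
    10 ^ 9 * B ^ 11 * max 1 (Real.log (1 / (σ * ε * c))) * (d ^ 2 / σ ^ 6 + d / c ^ 2) ≤
      14 * 10 ^ 9 * B ^ 16 * ((d / min σ c) ^ 7 * Real.log (1 / ε)) :=
  calc 10 ^ 9 * B ^ 11 * max 1 (Real.log (1 / (σ * ε * c))) * (d ^ 2 / σ ^ 6 + d / c ^ 2)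
      ≤ 10 ^ 9 * B ^ 11 * (7 * B * (d / min σ c * Real.log (1 / ε))) *
          (2 * B ^ 4 * (d / min σ c) ^ 6) := by
        gcongr
        · have hlog : 0 ≤ Real.log (1 / ε) := Real.log_nonneg (one_le_one_div hε (by linarith))
          positivity
        · exact max_one_log_le hd hσ hc hε hε2 hB hσB
        · exact div_add_div_le_div_min_pow hd hσ hc hB hσB
    _ = 14 * 10 ^ 9 * B ^ 16 * ((d / min σ c) ^ 7 * Real.log (1 / ε)) := by ring

theorem mainTheorem1 :
    ∃ p : ℕ, ∀ K : ℝ, 0 < K → ∃ C : ℝ, 0 < C ∧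
      ∀ (d : ℕ), 0 < d →
      ∀ (μ : Measure (EuclideanSpace ℝ (Fin d))) [IsProbabilityMeasure μ] (c ε σ : ℝ),
        PriorAssumption μ c ε σ K →
        (∀ lam : ℝ, 0 < lam → lam ≤ 1 → lam ≤ σ / d →
          ∃ alg : BanditAlgorithm d,
            alg.IsBIC μ ∧ alg.SpectrallyExplores μ lam ∧
            (alg.horizon : ℝ) ≤
              C * max 1 (Real.log (1 / (σ * ε * c))) *
                ((d : ℝ) ^ 5 / (lam ^ 4 * σ ^ 2) + (d : ℝ) ^ 4 / (c ^ 2 * lam ^ 4)) ∧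
            ∀ lamBar : ℝ, 0 < lamBar →
              (alg.repeatRuns ⌈lamBar / lam⌉₊).IsBIC μ ∧
              (alg.repeatRuns ⌈lamBar / lam⌉₊).SpectrallyExplores μ lamBar) ∧
        (∀ lamBar : ℝ, 0 < lamBar →
          ∃ alg : BanditAlgorithm d,
            alg.IsBIC μ ∧ alg.SpectrallyExplores μ lamBar ∧
            (alg.horizon : ℝ) ≤
              C * max 1 lamBar * ((d : ℝ) / min σ c) ^ p * Real.log (1 / ε)) := by
  refine ⟨7, fun K _ => ⟨28 * 10 ^ 9 * (1 + 4 * K ^ 4) ^ 16, by positivity,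
    fun d hd μ _ c ε σ h => ?_⟩⟩
  have hM : FourthMomentBound μ (1 + 4 * K ^ 4) := h.fourthMomentBound
  set B : ℝ := 1 + 4 * K ^ 4
  have hv : ‖(EuclideanSpace.single ⟨0, hd⟩ 1 : EuclideanSpace ℝ (Fin d))‖ = 1 := by simp
  have hd1 : (1 : ℝ) ≤ d := by exact_mod_cast hd
  obtain ⟨p, hp, hinf, hhor⟩ := h.exists_policy hM hd hv
  have hexp : p.toAlg.SpectrallyExplores μ 1 := by simpa using hinf.spectrallyExplores one_pos
  refine ⟨fun lam hlam hlam1 hlamσ => ⟨p.toAlg, hp.isBIC hM.integrable_id, hexp.mono hlam1,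
    hhor.trans ?_, fun lamBar _ => ⟨(hp.repeatRuns _).isBIC hM.integrable_id,
      ((hexp.mono hlam1).repeatRuns _).mono ((div_le_iff₀ hlam).1 (Nat.le_ceil _))⟩⟩,
    fun lamBar hlamBar => ⟨p.toAlg.repeatRuns ⌈lamBar⌉₊, (hp.repeatRuns _).isBIC hM.integrable_id,
      (hexp.repeatRuns _).mono ((Nat.le_ceil _).trans_eq (mul_one _).symm), ?_⟩⟩
  · gcongr ?_ * _ * ?_
    · gcongr <;> norm_num [hM.one_le]
    · exact div_add_div_le_of_le_div hd1 h.σ_pos h.c_pos hlam hlam1 hlamσ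
  · calc ((⌈lamBar⌉₊ * p.horizon : ℕ) : ℝ) ≤
          2 * max 1 lamBar * (14 * 10 ^ 9 * B ^ 16 * ((d / min σ c) ^ 7 * Real.log (1 / ε))) := by
          rw [Nat.cast_mul]
          gcongr
          · linarith [Nat.ceil_lt_add_one hlamBar.le, le_max_left 1 lamBar, le_max_right 1 lamBar]
          · exact hhor.trans <| rounds_le_div_min_pow hd1 h.σ_pos h.c_pos h.ε_pos
              (h.ε_le_half hv) hM.one_le (h.σ_le hM hv)
      _ = _ := by ring
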